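/- Let $n\ge 2$ be an integer. Let $G_0$ be the metric graph of genus 2 with two vertices $u_1,u_2$ of valence 3 joined by three edges $e_0,e_1,e_2$ of mutually different finite lengths, and let $m_i$ be the midpoint of $e_i$. Let $q_0,q_1,\dots,q_n$ be pairwise different points of $G_0$ such that $q_0=m_0$, $q_1$ lies in the open segment $]u_1,m_1[\,\subset e_1$ and $q_2$ lies in the open segment $]u_2,m_2[\,\subset e_2$. Let $G_n$ be the metric graph (of genus $n+3$) obtained from $G_0$ by attaching, for each $0\le i\le n$, a loop $\gamma_i$ of arbitrary finite positive length at $q_i$. For a divisor $D$ on a metric graph $\Gamma$, let $|D|$ be the set of effective divisors linearly equivalent to $D$, and let the rank $\operatorname{rk}(D)$ be the largest integer $k\ge -1$ such that $|D-E|\neq\emptyset$ for every effective divisor $E$ of degree $k$. We call $|D|$ a $g^r_d$ if $\deg D=d$ and $\operatorname{rk}(D)=r$. Put $w^r_d(\Gamma)=-1$ if $\Gamma$ has no $g^r_d$; otherwise $w^r_d(\Gamma)$ is the largest integer $w\ge 0$ such that for each effective divisor $F$ of degree $r+w$ there is an effective divisor $E$ of degree $d$ with $\operatorname{rk}(E)\ge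 r$ and $E-F\ge 0$. Then $w^1_4(G_n)=1$. Moreover, for any two (not necessarily different) points $v_1,v_2\in G_n$ there is a $g^1_4$ on $G_n$ that contains a divisor $E$ with $E-v_1-v_2\ge 0$. -/

import Mathlib

open Set Filter Topology

/-- A (compact) metric graph: finitely many closed segments `[0, len e]`, glued along finitely many
points. `pt e t` is the point of the graph at parameter `t` of the segment `e`; only the values for
`0 ≤ t ≤ len e` matter. The segments may meet each other or themselves at end points and at interior
points. -/
structure MetricGraph where
  Point : Type
  Edge : Type
  edge_finite : Finite Edge
  len : Edge → ℝ
  len_pos : ∀ e, 0 < len e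
  pt : Edge → ℝ → Point
  pt_surj : ∀ P, ∃ e, ∃ t ∈ Icc 0 (len e), pt e t = P
  glued_finite : {x : Edge × ℝ | x.2 ∈ Icc 0 (len x.1) ∧
    ∃ y : Edge × ℝ, y.2 ∈ Icc 0 (len y.1) ∧ y ≠ x ∧ pt y.1 y.2 = pt x.1 x.2}.Finite

namespace MetricGraph

variable (Γ : MetricGraph)

/-- All pairs (segment, parameter) that represent the point `P`. -/
def fiberSet (P : Γ.Point) : Set (Γ.Edge × ℝ) :=
  {x | x.2 ∈ Icc 0 (Γ.len x.1) ∧ Γ.pt x.1 x.2 = P}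

theorem fiberSet_finite (P : Γ.Point) : (Γ.fiberSet P).Finite := by
  by_cases h : (Γ.fiberSet P).Subsingleton
  · exact h.finite
  · refine Γ.glued_finite.subset fun x hx => ⟨hx.1, ?_⟩
    by_contra hne
    push Not at hne
    have key : ∀ y ∈ Γ.fiberSet P, y = x := fun y hy => by
      by_contra hyx
      exact hne y hy.1 hyx (hy.2.trans hx.2.symm)
    exact h fun a ha b hb => (key a ha).trans (key b hb).symm

/-- The fibre over `P` as a finite set. -/
noncomputable def fiber (P : Γ.Point) : Finset (Γ.Edge × ℝ) := (Γ.fiberSet_finite P).toFinset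

/-- A rational function: a continuous real function on the graph that is piecewise linear with
integer slopes on every segment. Near each parameter `t` it is linear, with integer slope, on the
right (if `t < len e`) and on the left (if `0 < t`); by compactness there are then only finitely many
pieces. `slopeR e t` and `slopeL e t` are the slopes in the two directions that point away from
`pt e t`; they are determined by the function. -/
structure RationalFunction where
  toFun : Γ.Point → ℝ
  slopeR : Γ.Edge → ℝ → ℤ
  slopeL : Γ.Edge → ℝ → ℤ
  right_linear : ∀ e, ∀ t ∈ Ico 0 (Γ.len e), ∀ᶠ s in 𝓝[>] t,
    toFun (Γ.pt e s) = toFun (Γ.pt e t) + slopeR e t * (s - t)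
  left_linear : ∀ e, ∀ t ∈ Ioc 0 (Γ.len e), ∀ᶠ s in 𝓝[<] t,
    toFun (Γ.pt e s) = toFun (Γ.pt e t) + slopeL e t * (t - s)

variable {Γ}

open Classical in
/-- The order of a rational function at `P`: the sum of its slopes in all tangent directions that
leave `P`. -/
noncomputable def RationalFunction.ord (f : Γ.RationalFunction) (P : Γ.Point) : ℤ :=
  ∑ x ∈ Γ.fiber P, ((if x.2 < Γ.len x.1 then f.slopeR x.1 x.2 else 0) +
    (if 0 < x.2 then f.slopeL x.1 x.2 else 0))

variable (Γ)

/-- Divisors: finite formal sums of points with integer coefficients. `0 ≤ D` means that `D` is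
effective. -/
abbrev Divisor := Γ.Point →₀ ℤ

variable {Γ}

/-- The degree of a divisor. -/
def deg (D : Γ.Divisor) : ℤ := D.sum fun _ m => m

/-- Linear equivalence: the difference is the divisor of a rational function. -/
def LinEquiv (D D' : Γ.Divisor) : Prop :=
  ∃ f : Γ.RationalFunction, ∀ P, D' P = D P + f.ord P

/-- The complete linear system `|D|`. -/
def linSys (D : Γ.Divisor) : Set Γ.Divisor := {D' | 0 ≤ D' ∧ LinEquiv D D'}

/-- The rank: the largest integer `k ≥ -1` such that `|D - E|` is non-empty for every effective
divisor `E` of degree `k` (the condition is void for `k = -1`). -/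
noncomputable def rank (D : Γ.Divisor) : ℤ :=
  sSup {k : ℤ | -1 ≤ k ∧ ∀ E : Γ.Divisor, 0 ≤ E → deg E = k → (linSys (D - E)).Nonempty}

/-- `|D|` is a linear system `g^r_d`. -/
def IsG (r d : ℕ) (D : Γ.Divisor) : Prop := deg D = d ∧ rank D = r

variable (Γ)

open Classical in
/-- The invariant `w^r_d`: it is `-1` if there is no `g^r_d`; otherwise it is the largest `w ≥ 0` such
that every effective divisor `F` of degree `r + w` satisfies `F ≤ E` for some effective divisor `E` of
degree `d` and rank at least `r`. -/
noncomputable def w (r d : ℕ) : ℤ :=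
  if ∃ D : Γ.Divisor, IsG r d D then
    sSup {k : ℤ | 0 ≤ k ∧ ∀ F : Γ.Divisor, 0 ≤ F → deg F = r + k →
      ∃ E : Γ.Divisor, 0 ≤ E ∧ deg E = d ∧ (r : ℤ) ≤ rank E ∧ F ≤ E}
  else -1

variable {Γ}

/-- The points of a graph with two vertices `v₁`, `v₂` joined by three edges of lengths `l e`. An
interior point of the edge `e` is given by its distance `t` to `v₁` along `e`. -/
inductive ThetaPoint (l : Fin 3 → ℝ) : Type
  | v₁ : ThetaPoint l
  | v₂ : ThetaPoint l
  | inner (e : Fin 3) (t : ℝ) (h : t ∈ Ioo 0 (l e)) : ThetaPoint l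

open Classical in
/-- The point on the edge `e` at distance `t` from `v₁`: `v₁` for `t = 0`, `v₂` for `t = l e`. -/
noncomputable def thetaPt (l : Fin 3 → ℝ) (e : Fin 3) (t : ℝ) : ThetaPoint l :=
  if h : t ∈ Ioo 0 (l e) then .inner e t h else if t ≤ 0 then .v₁ else .v₂

/-- The graph of genus 2 with two vertices `v₁`, `v₂` of valence 3 joined by three edges. -/
noncomputable def theta (l : Fin 3 → ℝ) (hl : ∀ e, 0 < l e) : MetricGraph where
  Point := ThetaPoint l
  Edge := Fin 3
  edge_finite := inferInstance
  len := l
  len_pos := hl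
  pt := thetaPt l
  pt_surj := by
    rintro (_ | _ | ⟨e, t, h⟩)
    · exact ⟨0, 0, ⟨le_rfl, (hl 0).le⟩, by simp [thetaPt]⟩
    · exact ⟨0, l 0, ⟨(hl 0).le, le_rfl⟩, by simp [thetaPt, hl 0]⟩
    · exact ⟨e, t, ⟨h.1.le, h.2.le⟩, by rw [thetaPt, dif_pos h]⟩
  glued_finite := by
    refine ((finite_range fun e : Fin 3 => (e, (0 : ℝ))).union
      (finite_range fun e : Fin 3 => (e, l e))).subset ?_
    rintro ⟨e, t⟩ ⟨ht, ⟨e', t'⟩, -, hne, heq⟩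
    by_cases h : t ∈ Ioo 0 (l e)
    · exfalso
      simp only [thetaPt, dif_pos h] at heq
      split_ifs at heq
      cases heq
      exact hne rfl
    · rcases ht.1.eq_or_lt with h0 | h0
      · exact Or.inl ⟨e, by simpa using h0⟩
      · refine Or.inr ⟨e, ?_⟩
        have : t = l e := le_antisymm ht.2 (not_lt.1 fun h1 => h ⟨h0, h1⟩)
        simp [this]

open Classical in
/-- Attach to `Γ`, for every `i`, a loop of length `c i` at the point `q i`: the two ends of a new
segment of length `c i` are identified with `q i`. -/
noncomputable def attachLoops (Γ : MetricGraph) {ι : Type} [Finite ι] (q : ι → Γ.Point) (c : ι → ℝ)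
    (hc : ∀ i, 0 < c i) : MetricGraph where
  Point := Γ.Point ⊕ (Σ i, Ioo 0 (c i))
  Edge := Γ.Edge ⊕ ι
  edge_finite := by
    have := Γ.edge_finite
    infer_instance
  len := Sum.elim Γ.len c
  len_pos := by
    rintro (e | i)
    · exact Γ.len_pos e
    · exact hc i
  pt := Sum.elim (fun e t => Sum.inl (Γ.pt e t))
    (fun i t => if h : t ∈ Ioo 0 (c i) then Sum.inr ⟨i, t, h⟩ else Sum.inl (q i))
  pt_surj := by
    rintro (P | ⟨i, t, h⟩)
    · obtain ⟨e, t, ht, rfl⟩ := Γ.pt_surj P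
      exact ⟨Sum.inl e, t, ht, rfl⟩
    · exact ⟨Sum.inr i, t, ⟨h.1.le, h.2.le⟩, dif_pos h⟩
  glued_finite := by
    refine ((((Γ.glued_finite.union (finite_iUnion fun i => Γ.fiberSet_finite (q i))).image
      (fun x : Γ.Edge × ℝ => ((Sum.inl x.1 : Γ.Edge ⊕ ι), x.2))).union
      (finite_range fun i : ι => ((Sum.inr i : Γ.Edge ⊕ ι), (0 : ℝ)))).union
      (finite_range fun i : ι => ((Sum.inr i : Γ.Edge ⊕ ι), c i))).subset ?_
    rintro ⟨e | i, t⟩ ⟨ht, ⟨e' | i', t'⟩, ht', hne, heq⟩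
    · refine Or.inl (Or.inl ⟨(e, t), Or.inl ⟨ht, (e', t'), ht', ?_, Sum.inl.inj heq⟩, rfl⟩)
      rintro h
      cases h
      exact hne rfl
    · refine Or.inl (Or.inl ⟨(e, t), Or.inr (mem_iUnion.2 ⟨i', ht, ?_⟩), rfl⟩)
      simp only [Sum.elim_inl, Sum.elim_inr] at heq
      split_ifs at heq
      exact (Sum.inl.inj heq).symm
    all_goals
      by_cases h : t ∈ Ioo 0 (c i)
      · exfalso
        simp only [Sum.elim_inl, Sum.elim_inr, dif_pos h] at heq
        first
          | cases heq
          | (split_ifs at heq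
             cases heq
             exact hne rfl)
      · rcases ht.1.eq_or_lt with h0 | h0
        · exact Or.inl (Or.inr ⟨i, by simp only at h0; rw [← h0]⟩)
        · refine Or.inr ⟨i, ?_⟩
          have : t = c i := le_antisymm ht.2 (not_lt.1 fun h1 => h ⟨h0, h1⟩)
          rw [this]

end MetricGraph

/-!
The proof rests on an explicit Abel–Jacobi theorem for a theta graph with loops. A piecewise linear
function on a segment is a sum of ramps (`IsSegmentPL.exists_rampSum`), so linear equivalence can be
read off from finite formal sums on the segments (`linEquiv_iff_exists_rampSum`). It follows that two
divisors are linearly equivalent if and only if they have the same degree, the same component in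
`ℝ/c i` for every loop, and the same image in the Jacobian `ThetaJac l` of the theta graph, where every
point of a loop counts as the base point of the loop (`LinEquiv.invariants`,
`linEquiv_of_invariants`). Everything else is a computation with these invariants.

*Pencils.* On the theta graph every element of the Jacobian is the class of two points
(`exists_thetaClass_add_eq`). Let `D` have degree `4` and trivial components at all loops, and let `P`
be any point. Then `|D - P|` contains a divisor consisting of two points of the theta graph and the
reflection of `P`, so `D` has rank at least `1`. On the other hand, a divisor with a non-trivial
component at a loop has, in each effective representative, a point inside this loop
(`exists_sub_of_ajLoop_ne_zero`). If one subtracts the midpoints of the loops at `q₁` and `q₂`, or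
those of the loops at `q₀` and `q₂`, then an effective representative can exist only if `D` has the
class of `2q₁ + 2q₂`, respectively `2q₀ + 2q₂`. These classes differ because `2q₀` is canonical and
`2q₁` is not; hence the rank is exactly `1`. Any two points together with their reflections form such
a divisor `D`, which gives the second assertion and `w ≥ 1`.

*The upper bound.* Two interior points of different edges of the theta graph are rigid: every
effective divisor equivalent to their sum is the sum itself (`eq_or_eq_of_thetaClass_add_eq` records
the part that is needed). Together with `P + P' ~ K` for a point `P` and its mirror image `P'` on its
edge, this shows that no divisor of degree `4` and rank at least `1` contains the midpoints of the
loops at `q₀` and `q₁` and the mirror image of `q₁` (`not_le_of_one_le_rank`); hence `w < 2`.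
-/

/-! ### Piecewise linear functions on a segment -/

/-- `g` is piecewise linear on `[0, L]` with integer slopes: `sR t` and `sL t` are the slopes of `g`
at `t` in the two directions pointing away from `t`. -/
structure IsSegmentPL (g : ℝ → ℝ) (L : ℝ) (sR sL : ℝ → ℤ) : Prop where
  right : ∀ t ∈ Ico 0 L, ∀ᶠ s in 𝓝[>] t, g s = g t + sR t * (s - t)
  left : ∀ t ∈ Ioc 0 L, ∀ᶠ s in 𝓝[<] t, g s = g t + sL t * (t - s)

/-- The sum of the outgoing slopes at the parameter `t` of the segment `[0, L]`. -/
noncomputable def segmentOrd (L : ℝ) (sR sL : ℝ → ℤ) (t : ℝ) : ℤ :=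
  (if t < L then sR t else 0) + (if 0 < t then sL t else 0)

/-- The total coefficient of a finite formal sum of real numbers. -/
noncomputable def mass : (ℝ →₀ ℤ) →+ ℤ := Finsupp.liftAddHom fun _ => AddMonoidHom.id ℤ

/-- The value `∑ kᵢ sᵢ` of a finite formal sum `∑ kᵢ [sᵢ]` of real numbers. -/
noncomputable def moment : (ℝ →₀ ℤ) →+ ℝ :=
  Finsupp.liftAddHom fun s => (AddMonoidHom.mulRight s).comp (Int.castAddHom ℝ)

/-- The piecewise linear function `x ↦ ∑ kᵢ max (x - sᵢ) 0` whose slope increases by `kᵢ` at `sᵢ`. -/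
noncomputable def rampSum (m : ℝ →₀ ℤ) (x : ℝ) : ℝ := m.sum fun s k => (k : ℝ) * max (x - s) 0

theorem mass_eq (m : ℝ →₀ ℤ) : mass m = ∑ s ∈ m.support, m s := rfl

theorem moment_eq (m : ℝ →₀ ℤ) : moment m = ∑ s ∈ m.support, (m s : ℝ) * s := rfl

@[simp] theorem mass_single (s : ℝ) (k : ℤ) : mass (Finsupp.single s k) = k := by
  simp [mass]

@[simp] theorem moment_single (s : ℝ) (k : ℤ) : moment (Finsupp.single s k) = k * s := by
  simp [moment]

theorem isSegmentPL_rampSum (m : ℝ →₀ ℤ) (L : ℝ) :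
    IsSegmentPL (rampSum m) L (fun t => ∑ s ∈ m.support, if s ≤ t then m s else 0)
      (fun t => - ∑ s ∈ m.support, if s < t then m s else 0) := by
  constructor
  · intro t _
    have h : ∀ s ∈ m.support, ∀ᶠ x in 𝓝[>] t,
        max (x - s) 0 = max (t - s) 0 + (if s ≤ t then 1 else 0) * (x - t) := by
      intro s _
      split_ifs with hs
      · filter_upwards [self_mem_nhdsWithin] with x (hx : t < x)
        rw [max_eq_left (by linarith), max_eq_left (by linarith)]
        ring
      · push Not at hs
        filter_upwards [Ioo_mem_nhdsGT hs] with x hx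
        rw [max_eq_right (by linarith [hx.2]), max_eq_right (by linarith)]
        ring
    filter_upwards [(Finset.eventually_all _).2 h] with x hx
    simp only [rampSum, Finsupp.sum]
    push_cast
    rw [Finset.sum_mul, ← Finset.sum_add_distrib]
    refine Finset.sum_congr rfl fun s hs => ?_
    rw [hx s hs]
    split_ifs <;> ring
  · intro t _
    have h : ∀ s ∈ m.support, ∀ᶠ x in 𝓝[<] t,
        max (x - s) 0 = max (t - s) 0 - (if s < t then 1 else 0) * (t - x) := by
      intro s _
      split_ifs with hs
      · filter_upwards [Ioo_mem_nhdsLT hs] with x hx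
        rw [max_eq_left (by linarith [hx.1]), max_eq_left (by linarith)]
        ring
      · push Not at hs
        filter_upwards [self_mem_nhdsWithin] with x (hx : x < t)
        rw [max_eq_right (by linarith), max_eq_right (by linarith)]
        ring
    filter_upwards [(Finset.eventually_all _).2 h] with x hx
    simp only [rampSum, Finsupp.sum]
    push_cast
    rw [neg_mul, Finset.sum_mul, ← sub_eq_add_neg, ← Finset.sum_sub_distrib]
    refine Finset.sum_congr rfl fun s hs => ?_
    rw [hx s hs]
    split_ifs <;> ring

theorem rampSum_zero {m : ℝ →₀ ℤ} {L : ℝ} (hm : ∀ s ∈ m.support, s ∈ Icc 0 L) :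
    rampSum m 0 = 0 :=
  Finset.sum_eq_zero fun s hs => by
    have := (hm s hs).1
    simp [this]

theorem rampSum_right {m : ℝ →₀ ℤ} {L : ℝ} (hm : ∀ s ∈ m.support, s ∈ Icc 0 L)
    (h0 : mass m = 0) : rampSum m L = - moment m := by
  have h1 : ((∑ s ∈ m.support, m s : ℤ) : ℝ) = 0 := by rw [← mass_eq, h0, Int.cast_zero]
  push_cast at h1
  have h2 : rampSum m L = ∑ s ∈ m.support, ((m s : ℝ) * L - m s * s) :=
    Finset.sum_congr rfl fun s hs => by
      simp only [max_eq_left (sub_nonneg.2 (hm s hs).2)]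
      ring
  rw [h2, Finset.sum_sub_distrib, ← Finset.sum_mul, h1, moment_eq]
  ring

theorem sum_support_le (m : ℝ →₀ ℤ) (t : ℝ) : (∑ s ∈ m.support, if s ≤ t then m s else 0) =
    (∑ s ∈ m.support, if s < t then m s else 0) + m t := by
  have h1 : m t = ∑ s ∈ m.support, if s = t then m s else 0 := by
    rw [Finset.sum_ite_eq' m.support t]
    split_ifs with h
    · rfl
    · exact Finsupp.notMem_support_iff.1 h
  rw [h1, ← Finset.sum_add_distrib]
  refine Finset.sum_congr rfl fun s _ => ?_
  rcases lt_trichotomy s t with h | h | h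
  · simp [h, h.le, h.ne]
  · simp [h]
  · simp [not_le.2 h, not_lt.2 h.le, h.ne']

/-- At interior parameters this is the jump of the slope; at the two ends one of the two slopes is
missing, and the vanishing of the mass makes the formula hold there as well. -/
theorem segmentOrd_rampSum {m : ℝ →₀ ℤ} {L : ℝ} (hL : 0 < L)
    (hm : ∀ s ∈ m.support, s ∈ Icc 0 L) (h0 : mass m = 0) {t : ℝ} (ht : t ∈ Icc 0 L) :
    segmentOrd L (fun t => ∑ s ∈ m.support, if s ≤ t then m s else 0)
      (fun t => - ∑ s ∈ m.support, if s < t then m s else 0) t = m t := by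
  classical
  have key := sum_support_le m t
  unfold segmentOrd
  rcases ht.1.eq_or_lt with rfl | h1
  · have : (∑ s ∈ m.support, if s < 0 then m s else 0) = 0 :=
      Finset.sum_eq_zero fun s hs => if_neg (not_lt.2 (hm s hs).1)
    rw [this] at key
    simpa [hL] using key
  rcases ht.2.eq_or_lt with rfl | h2
  · have : (∑ s ∈ m.support, if s ≤ t then m s else 0) = 0 := by
      rw [← h0, mass_eq]
      exact Finset.sum_congr rfl fun s hs => if_pos (hm s hs).2
    rw [this] at key
    simp only [lt_irrefl, if_false, hL, if_true]
    linarith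
  · simp only [h1, h2, if_true]
    linarith

namespace IsSegmentPL

variable {g h : ℝ → ℝ} {L : ℝ} {sR sL rR rL : ℝ → ℤ}

theorem sub (hg : IsSegmentPL g L sR sL) (hh : IsSegmentPL h L rR rL) :
    IsSegmentPL (fun t => g t - h t) L (fun t => sR t - rR t) (fun t => sL t - rL t) where
  right t ht := by
    filter_upwards [hg.right t ht, hh.right t ht] with s h1 h2
    rw [h1, h2]
    push_cast
    ring
  left t ht := by
    filter_upwards [hg.left t ht, hh.left t ht] with s h1 h2
    rw [h1, h2]
    push_cast
    ring

theorem slopeR_eq (hg : IsSegmentPL g L sR sL) {t : ℝ} (ht : t ∈ Ico 0 L) {a : ℤ} {b : ℝ}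
    (h : ∀ᶠ s in 𝓝 t, g s = a * s + b) : sR t = a := by
  have h1 := h.self_of_nhds
  obtain ⟨s, hs1, hs2, hs3⟩ := ((hg.right t ht).and
    ((h.filter_mono nhdsWithin_le_nhds).and self_mem_nhdsWithin)).exists
  have hs4 : t < s := hs3
  have : (sR t : ℝ) = a := by
    refine mul_right_cancel₀ (sub_ne_zero.2 hs4.ne') ?_
    linarith
  exact_mod_cast this

theorem slopeL_eq (hg : IsSegmentPL g L sR sL) {t : ℝ} (ht : t ∈ Ioc 0 L) {a : ℤ} {b : ℝ}
    (h : ∀ᶠ s in 𝓝 t, g s = a * s + b) : sL t = -a := by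
  have h1 := h.self_of_nhds
  obtain ⟨s, hs1, hs2, hs3⟩ := ((hg.left t ht).and
    ((h.filter_mono nhdsWithin_le_nhds).and self_mem_nhdsWithin)).exists
  have hs4 : s < t := hs3
  have : (sL t : ℝ) = -a := by
    refine mul_right_cancel₀ (sub_ne_zero.2 hs4.ne') ?_
    linarith
  exact_mod_cast this

theorem eventually_right (hg : IsSegmentPL g L sR sL) {t : ℝ} (ht : t ∈ Ico 0 L) :
    ∀ᶠ s in 𝓝[>] t, sR s = sR t ∧ sL s = - sR t := by
  filter_upwards [eventually_eventually_nhdsWithin.2 (hg.right t ht), Ioo_mem_nhdsGT ht.2]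
    with s h1 h2
  rw [nhdsWithin_eq_nhds.2 (Ioi_mem_nhds h2.1)] at h1
  have h3 : ∀ᶠ x in 𝓝 s, g x = (sR t) * x + (g t - sR t * t) := by
    filter_upwards [h1] with x hx
    rw [hx]
    ring
  have h4 := ht.1.trans_lt h2.1
  exact ⟨hg.slopeR_eq ⟨h4.le, h2.2⟩ h3, hg.slopeL_eq ⟨h4, h2.2.le⟩ h3⟩

theorem eventually_left (hg : IsSegmentPL g L sR sL) {t : ℝ} (ht : t ∈ Ioc 0 L) :
    ∀ᶠ s in 𝓝[<] t, sR s = - sL t ∧ sL s = sL t := by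
  filter_upwards [eventually_eventually_nhdsWithin.2 (hg.left t ht), Ioo_mem_nhdsLT ht.1]
    with s h1 h2
  rw [nhdsWithin_eq_nhds.2 (Iio_mem_nhds h2.2)] at h1
  have h3 : ∀ᶠ x in 𝓝 s, g x = ((-sL t : ℤ) : ℝ) * x + (g t + sL t * t) := by
    filter_upwards [h1] with x hx
    rw [hx]
    push_cast
    ring
  have h4 := h2.2.trans_le ht.2
  exact ⟨hg.slopeR_eq ⟨h2.1.le, h4⟩ h3, by simpa using hg.slopeL_eq ⟨h2.1, h4.le⟩ h3⟩

theorem continuousOn (hg : IsSegmentPL g L sR sL) : ContinuousOn g (Icc 0 L) := by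
  intro t ht
  have hR : ContinuousWithinAt g (Icc 0 L ∩ Ioi t) t := by
    by_cases h : t < L
    · have h1 : Tendsto (fun s => g t + sR t * (s - t)) (𝓝[>] t) (𝓝 (g t)) := by
        have : ContinuousAt (fun s => g t + sR t * (s - t)) t := by fun_prop
        simpa using this.tendsto.mono_left nhdsWithin_le_nhds
      exact (h1.congr' ((hg.right t ⟨ht.1, h⟩).mono fun s hs => hs.symm)).mono_left
        (nhdsWithin_mono _ inter_subset_right)
    · have : Icc 0 L ∩ Ioi t = ∅ := by
        ext s
        simp only [mem_inter_iff, mem_Icc, mem_Ioi, mem_empty_iff_false, iff_false]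
        rintro ⟨⟨-, h1⟩, h2⟩
        exact h (h2.trans_le h1)
      simp [this, ContinuousWithinAt]
  have hL : ContinuousWithinAt g (Icc 0 L ∩ Iio t) t := by
    by_cases h : 0 < t
    · have h1 : Tendsto (fun s => g t + sL t * (t - s)) (𝓝[<] t) (𝓝 (g t)) := by
        have : ContinuousAt (fun s => g t + sL t * (t - s)) t := by fun_prop
        simpa using this.tendsto.mono_left nhdsWithin_le_nhds
      exact (h1.congr' ((hg.left t ⟨h, ht.2⟩).mono fun s hs => hs.symm)).mono_left
        (nhdsWithin_mono _ inter_subset_right)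
    · have : Icc 0 L ∩ Iio t = ∅ := by
        ext s
        simp only [mem_inter_iff, mem_Icc, mem_Iio, mem_empty_iff_false, iff_false]
        rintro ⟨⟨h1, -⟩, h2⟩
        exact h (h1.trans_lt h2)
      simp [this, ContinuousWithinAt]
  have := (hR.union hL).union (continuousWithinAt_singleton (f := g) (x := t))
  refine this.mono fun s hs => ?_
  rcases lt_trichotomy s t with h | h | h
  · exact Or.inl (Or.inr ⟨hs, h⟩)
  · exact Or.inr h
  · exact Or.inl (Or.inl ⟨hs, h⟩)

/-- Without breakpoints, the right slope is locally constant, hence constant. -/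
theorem eq_const (hg : IsSegmentPL g L sR sL) (hL : 0 < L) (h0 : sR 0 = 0)
    (h : ∀ t ∈ Ioo 0 L, sR t + sL t = 0) : (∀ t ∈ Icc 0 L, g t = g 0) ∧ sL L = 0 := by
  have hc : ContinuousOn sR (Ico 0 L) := by
    intro t ht
    have h1 : ∀ᶠ s in 𝓝[Ico 0 L] t, sR s = sR t := by
      have hR : ∀ᶠ s in 𝓝[Ico 0 L ∩ Ioi t] t, sR s = sR t :=
        ((hg.eventually_right ht).mono fun s hs => hs.1).filter_mono
          (nhdsWithin_mono _ inter_subset_right)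
      have hL' : ∀ᶠ s in 𝓝[Ico 0 L ∩ Iio t] t, sR s = sR t := by
        by_cases h3 : 0 < t
        · refine ((hg.eventually_left ⟨h3, ht.2.le⟩).mono fun s hs => ?_).filter_mono
            (nhdsWithin_mono _ inter_subset_right)
          linarith [hs.1, h t ⟨h3, ht.2⟩]
        · filter_upwards [self_mem_nhdsWithin] with s hs
          exact absurd (hs.1.1.trans_lt hs.2) h3
      have hE : ∀ᶠ s in 𝓝[{t}] t, sR s = sR t := by
        filter_upwards [self_mem_nhdsWithin] with s hs
        rw [mem_singleton_iff.1 hs]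
      have h4 := eventually_sup.2 ⟨eventually_sup.2 ⟨hR, hL'⟩, hE⟩
      rw [← nhdsWithin_union, ← nhdsWithin_union] at h4
      refine h4.filter_mono (nhdsWithin_mono _ fun s hs => ?_)
      rcases lt_trichotomy s t with h | h | h
      · exact Or.inl (Or.inr ⟨hs, h⟩)
      · exact Or.inr h
      · exact Or.inl (Or.inl ⟨hs, h⟩)
    exact (tendsto_const_nhds (x := sR t)).congr' (h1.mono fun s hs => hs.symm)
  have hz : ∀ t ∈ Ico 0 L, sR t = 0 := fun t ht =>
    (isPreconnected_Ico.constant hc ht ⟨le_rfl, hL⟩).trans h0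
  have hconst : ∀ t ∈ Icc 0 L, g t = g 0 := by
    refine constant_of_has_deriv_right_zero hg.continuousOn fun t ht => ?_
    rw [← hasDerivWithinAt_Ioi_iff_Ici]
    refine (hasDerivWithinAt_const t (Ioi t) (g t)).congr_of_eventuallyEq ?_ rfl
    filter_upwards [hg.right t ht] with s hs
    rw [hs, hz t ht]
    simp
  refine ⟨hconst, ?_⟩
  obtain ⟨s, hs1, hs2⟩ := ((hg.left L ⟨hL, le_rfl⟩).and (Ioo_mem_nhdsLT hL)).exists
  rw [hconst s ⟨hs2.1.le, hs2.2.le⟩, hconst L ⟨hL.le, le_rfl⟩] at hs1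
  have h5 : (sL L : ℝ) * (L - s) = 0 := by linarith
  have h6 := (mul_eq_zero.1 h5).resolve_right (sub_ne_zero.2 hs2.2.ne')
  exact_mod_cast h6

theorem finite_breakpoints (hg : IsSegmentPL g L sR sL) :
    {t | t ∈ Icc 0 L ∧ segmentOrd L sR sL t ≠ 0}.Finite := by
  set T := {t | t ∈ Icc 0 L ∧ segmentOrd L sR sL t ≠ 0} with hT
  suffices h : (Icc 0 L ∩ T).Finite from h.subset fun t ht => ⟨ht.1, ht⟩
  refine (isCompact_Icc (a := (0 : ℝ)) (b := L)).induction_on (p := fun s => (s ∩ T).Finite)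
    (by simp) (fun s t hst ht => ht.subset (inter_subset_inter_left _ hst))
    (fun s t hs ht => by rw [union_inter_distrib_right]; exact hs.union ht) fun t ht => ?_
  have hR : ∀ᶠ s in 𝓝[>] t, s ∉ T := by
    by_cases h : t < L
    · filter_upwards [hg.eventually_right ⟨ht.1, h⟩, Ioo_mem_nhdsGT h] with s hs hs2 hs3
      exact hs3.2 (by simp [segmentOrd, hs2.2, ht.1.trans_lt hs2.1, hs.1, hs.2])
    · filter_upwards [self_mem_nhdsWithin] with s (hs : t < s) hs3
      exact h (hs.trans_le hs3.1.2)
  have hL : ∀ᶠ s in 𝓝[<] t, s ∉ T := by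
    by_cases h : 0 < t
    · filter_upwards [hg.eventually_left ⟨h, ht.2⟩, Ioo_mem_nhdsLT h] with s hs hs2 hs3
      exact hs3.2 (by simp [segmentOrd, hs2.2.trans_le ht.2, hs2.1, hs.1, hs.2])
    · filter_upwards [self_mem_nhdsWithin] with s (hs : s < t) hs3
      exact h (hs3.1.1.trans_lt hs)
  have h1 : ∀ᶠ s in 𝓝[≠] t, s ∉ T := by
    rw [← Iio_union_Ioi, nhdsWithin_union]
    exact eventually_sup.2 ⟨hL, hR⟩
  refine ⟨{s | s ∉ T} ∪ {t}, mem_nhdsWithin_of_mem_nhds ?_, ?_⟩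
  · rw [eventually_nhdsWithin_iff] at h1
    filter_upwards [h1] with s hs
    by_cases hst : s = t
    · exact Or.inr hst
    · exact Or.inl (hs hst)
  · refine (finite_singleton t).subset ?_
    rintro s ⟨h2 | h2, h3⟩
    · exact absurd h3 h2
    · exact h2

/-- A piecewise linear function on a segment is a sum of ramps, up to a constant: one ramp for each
breakpoint, with the order there as its coefficient. -/
theorem exists_rampSum (hg : IsSegmentPL g L sR sL) (hL : 0 < L) :
    ∃ m : ℝ →₀ ℤ, (∀ s ∈ m.support, s ∈ Icc 0 L) ∧ mass m = 0 ∧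
      (∀ t ∈ Icc 0 L, segmentOrd L sR sL t = m t) ∧
      ∀ t ∈ Icc 0 L, g t = g 0 + rampSum m t := by
  classical
  let o : ℝ → ℤ := fun t => if t ∈ Icc 0 L then segmentOrd L sR sL t else 0
  have ho : (Function.support o).Finite := hg.finite_breakpoints.subset fun t ht => by
    by_cases h : t ∈ Icc 0 L
    · exact ⟨h, by simpa [o, h.1, h.2] using ht⟩
    · exact absurd (if_neg h) ht
  let m := Finsupp.ofSupportFinite o ho
  have hmt : ∀ t, m t = o t := fun t => rfl
  have hm : ∀ s ∈ m.support, s ∈ Icc 0 L := fun s hs => by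
    by_contra h
    exact Finsupp.mem_support_iff.1 hs (if_neg h)
  have hord : ∀ t ∈ Icc 0 L, segmentOrd L sR sL t = m t := fun t ht => (if_pos ht).symm
  have hd := hg.sub (isSegmentPL_rampSum m L)
  have hsum := sum_support_le m
  obtain ⟨h1, h2⟩ := hd.eq_const hL (by
    have h3 : (∑ s ∈ m.support, if s < 0 then m s else 0) = 0 :=
      Finset.sum_eq_zero fun s hs => if_neg (not_lt.2 (hm s hs).1)
    have h4 := hord 0 ⟨le_rfl, hL.le⟩
    simp only [segmentOrd, hL, if_true, lt_irrefl, if_false] at h4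
    rw [hsum, h3]
    linarith) (fun t ht => by
    have h4 := hord t ⟨ht.1.le, ht.2.le⟩
    simp only [segmentOrd, ht.1, ht.2, if_true] at h4
    rw [hsum]
    linarith)
  refine ⟨m, hm, ?_, hord, fun t ht => ?_⟩
  · have h3 : mass m = ∑ s ∈ m.support, if s ≤ L then m s else 0 := by
      rw [mass_eq]
      exact Finset.sum_congr rfl fun s hs => (if_pos (hm s hs).2).symm
    have h4 := hord L ⟨hL.le, le_rfl⟩
    simp only [segmentOrd, hL, if_true, lt_irrefl, if_false] at h4
    rw [h3, hsum]
    linarith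
  · have := h1 t ht
    rw [rampSum_zero hm] at this
    linarith

end IsSegmentPL

/-! ### Linear equivalence, degree and rank on a metric graph -/

namespace MetricGraph

variable {Γ : MetricGraph}

theorem mem_fiber {P : Γ.Point} {x : Γ.Edge × ℝ} :
    x ∈ Γ.fiber P ↔ x.2 ∈ Icc 0 (Γ.len x.1) ∧ Γ.pt x.1 x.2 = P := by
  simp [fiber, fiberSet]

/-- A sum over the fibre of `P` of coefficients of formal sums on the segments is the coefficient at
`P` of the divisor obtained by pushing these formal sums forward to the graph. -/
theorem sum_fiber_eq [Fintype Γ.Edge] (m : Γ.Edge → ℝ →₀ ℤ)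
    (hm : ∀ e, ∀ s ∈ (m e).support, s ∈ Icc 0 (Γ.len e)) (P : Γ.Point) :
    ∑ x ∈ Γ.fiber P, m x.1 x.2 = (∑ e, (m e).mapDomain (Γ.pt e)) P := by
  classical
  rw [Finsupp.finsetSum_apply, ← Finset.sum_fiberwise (Γ.fiber P) Prod.fst]
  refine Finset.sum_congr rfl fun e _ => ?_
  have h1 : (m e).mapDomain (Γ.pt e) P = ∑ s ∈ (m e).support with Γ.pt e s = P, m e s := by
    simp [Finsupp.mapDomain, Finsupp.sum, Finsupp.single_apply, Finset.sum_ite]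
  rw [h1]
  refine Finset.sum_bij_ne_zero (fun x _ _ => x.2) ?_ ?_ ?_ ?_
  · intro x hx hx0
    simp only [Finset.mem_filter, mem_fiber, Finsupp.mem_support_iff] at hx ⊢
    obtain ⟨⟨-, h3⟩, rfl⟩ := hx
    exact ⟨hx0, h3⟩
  · rintro ⟨a, s⟩ hx _ ⟨b, t⟩ hy _ (rfl : s = t)
    rw [Finset.mem_filter] at hx hy
    rw [Prod.mk.injEq]
    exact ⟨hx.2.trans hy.2.symm, rfl⟩
  · intro s hs hs0
    simp only [Finset.mem_filter] at hs
    exact ⟨(e, s), by simp [mem_fiber, hm e s hs.1, hs.2] , hs0, rfl⟩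
  · intro x hx _
    simp only [Finset.mem_filter] at hx
    rw [hx.2]

/-- Linear equivalence, expressed by the breakpoints of the rational function: on every segment `e`
a formal sum `m e` of mass `0`, such that the corresponding sums of ramps fit together to a function
`F` on the graph. -/
theorem linEquiv_iff_exists_rampSum [Fintype Γ.Edge] {D D' : Γ.Divisor} :
    LinEquiv D D' ↔ ∃ (m : Γ.Edge → ℝ →₀ ℤ) (F : Γ.Point → ℝ),
      (∀ e, (∀ s ∈ (m e).support, s ∈ Icc 0 (Γ.len e)) ∧ mass (m e) = 0 ∧
        ∀ t ∈ Icc 0 (Γ.len e), F (Γ.pt e t) = F (Γ.pt e 0) + rampSum (m e) t) ∧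
      D' - D = ∑ e, (m e).mapDomain (Γ.pt e) := by
  constructor
  · rintro ⟨f, hf⟩
    have hpl : ∀ e, IsSegmentPL (fun t => f.toFun (Γ.pt e t)) (Γ.len e) (f.slopeR e)
        (f.slopeL e) := fun e => ⟨f.right_linear e, f.left_linear e⟩
    choose m hm h0 hord hF using fun e => (hpl e).exists_rampSum (Γ.len_pos e)
    refine ⟨m, f.toFun, fun e => ⟨hm e, h0 e, hF e⟩, Finsupp.ext fun P => ?_⟩
    rw [← sum_fiber_eq m hm P, Finsupp.sub_apply, hf P, add_sub_cancel_left]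
    exact Finset.sum_congr rfl fun x hx => hord x.1 x.2 (mem_fiber.1 hx).1
  · rintro ⟨m, F, h, hD⟩
    have hpl : ∀ e, IsSegmentPL (fun t => F (Γ.pt e t)) (Γ.len e)
        (fun t => ∑ s ∈ (m e).support, if s ≤ t then m e s else 0)
        (fun t => - ∑ s ∈ (m e).support, if s < t then m e s else 0) := by
      intro e
      have hr := isSegmentPL_rampSum (m e) (Γ.len e)
      constructor
      · intro t ht
        filter_upwards [hr.right t ht, Ioo_mem_nhdsGT ht.2] with s h1 h2
        rw [(h e).2.2 s ⟨ht.1.trans h2.1.le, h2.2.le⟩, (h e).2.2 t ⟨ht.1, ht.2.le⟩, h1]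
        ring
      · intro t ht
        filter_upwards [hr.left t ht, Ioo_mem_nhdsLT ht.1] with s h1 h2
        rw [(h e).2.2 s ⟨h2.1.le, h2.2.le.trans ht.2⟩, (h e).2.2 t ⟨ht.1.le, ht.2⟩, h1]
        ring
    refine ⟨⟨F, _, _, fun e => (hpl e).right, fun e => (hpl e).left⟩, fun P => ?_⟩
    rw [← sub_eq_iff_eq_add', ← Finsupp.sub_apply, hD, ← sum_fiber_eq m (fun e => (h e).1) P]
    exact Finset.sum_congr rfl fun x hx => (segmentOrd_rampSum (Γ.len_pos x.1) (h x.1).1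
      (h x.1).2.1 (mem_fiber.1 hx).1).symm

/-- The degree as a homomorphism. -/
noncomputable def degHom : Γ.Divisor →+ ℤ := Finsupp.liftAddHom fun _ => AddMonoidHom.id ℤ

theorem deg_eq_degHom (D : Γ.Divisor) : deg D = degHom D := rfl

@[simp] theorem degHom_single (P : Γ.Point) (k : ℤ) : degHom (Finsupp.single P k) = k := by
  simp [degHom]

theorem degHom_mapDomain (p : ℝ → Γ.Point) (m : ℝ →₀ ℤ) : degHom (m.mapDomain p) = mass m := by
  induction m using Finsupp.induction_linear with
  | zero => simp
  | add f g hf hg => rw [Finsupp.mapDomain_add, map_add, map_add, hf, hg]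
  | single a b => simp

theorem degHom_nonneg {D : Γ.Divisor} (hD : 0 ≤ D) : 0 ≤ degHom D :=
  Finset.sum_nonneg fun P _ => hD P

theorem eq_zero_of_degHom_eq_zero {D : Γ.Divisor} (hD : 0 ≤ D) (h : degHom D = 0) : D = 0 := by
  ext P
  by_contra hP
  have := (Finset.sum_eq_zero_iff_of_nonneg (s := D.support) (fun Q _ => hD Q)).1 h P
    (Finsupp.mem_support_iff.2 hP)
  exact hP this

theorem single_le_of_pos {D : Γ.Divisor} (hD : 0 ≤ D) {P : Γ.Point} (hP : 0 < D P) :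
    Finsupp.single P 1 ≤ D := by
  intro Q
  rcases eq_or_ne P Q with rfl | hne
  · rw [Finsupp.single_eq_same]
    exact hP
  · simpa [Finsupp.single_eq_of_ne' hne] using hD Q

theorem exists_single_le {D : Γ.Divisor} (hD : 0 ≤ D) (h : 0 < degHom D) :
    ∃ P, Finsupp.single P 1 ≤ D := by
  obtain ⟨P, -, hP⟩ : ∃ P ∈ D.support, 0 < D P := by
    by_contra! hc
    exact h.not_ge (Finset.sum_nonpos hc)
  exact ⟨P, single_le_of_pos hD hP⟩

theorem exists_eq_single {D : Γ.Divisor} (hD : 0 ≤ D) (h : degHom D = 1) :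
    ∃ P, D = Finsupp.single P 1 := by
  obtain ⟨P, hP⟩ := exists_single_le hD (by omega)
  exact ⟨P, sub_eq_zero.1 (eq_zero_of_degHom_eq_zero (sub_nonneg.2 hP) (by simp [h]))⟩

theorem LinEquiv.congr_sub {D D' E E' : Γ.Divisor} (h : LinEquiv D D') (hE : E' - E = D' - D) :
    LinEquiv E E' := by
  obtain ⟨f, hf⟩ := h
  refine ⟨f, fun P => ?_⟩
  have := DFunLike.congr_fun hE P
  simp only [Finsupp.sub_apply] at this
  linarith [hf P]

/-- Subtracting fewer points leaves more effective divisors. -/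
theorem linSys_nonempty_mono {D E E' : Γ.Divisor} (h : E ≤ E')
    (hE : (linSys (D - E')).Nonempty) : (linSys (D - E)).Nonempty := by
  obtain ⟨A, hA, hl⟩ := hE
  exact ⟨A + (E' - E), add_nonneg hA (sub_nonneg.2 h), hl.congr_sub (by abel)⟩

theorem single_nonneg {P : Γ.Point} {k : ℤ} (hk : 0 ≤ k) :
    (0 : Γ.Divisor) ≤ Finsupp.single P k := Finsupp.single_nonneg.2 hk

/-- The rank is `1` as soon as every point, but not every pair of points, can be subtracted. -/
theorem rank_eq_one {D : Γ.Divisor} (h1 : ∀ P, (linSys (D - Finsupp.single P 1)).Nonempty)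
    {E : Γ.Divisor} (hE : 0 ≤ E) (hd : degHom E = 2) (h2 : ¬ (linSys (D - E)).Nonempty) :
    rank D = 1 := by
  refine IsGreatest.csSup_eq ⟨⟨by norm_num, fun A hA hA1 => ?_⟩, fun k hk => ?_⟩
  · obtain ⟨P, rfl⟩ := exists_eq_single hA hA1
    exact h1 P
  · by_contra! hk1
    obtain ⟨P, -⟩ := exists_single_le hE (by omega)
    refine h2 (linSys_nonempty_mono (le_add_of_nonneg_right (single_nonneg (by omega : 0 ≤ k - 2)))
      (hk.2 (E + Finsupp.single P (k - 2)) (add_nonneg hE (single_nonneg (by omega))) ?_))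
    rw [deg_eq_degHom, map_add, hd, degHom_single]
    ring

theorem linSys_nonempty_of_one_le_rank {D : Γ.Divisor} (h : 1 ≤ rank D) (P : Γ.Point) :
    (linSys (D - Finsupp.single P 1)).Nonempty := by
  set K : Set ℤ := {k : ℤ | -1 ≤ k ∧
    ∀ E : Γ.Divisor, 0 ≤ E → deg E = k → (linSys (D - E)).Nonempty} with hK
  have hr : rank D = sSup K := rfl
  have hbdd : BddAbove K := by
    by_contra hb
    rw [hr, Int.csSup_of_not_bddAbove hb] at h
    norm_num at h
  have hne : K.Nonempty := ⟨-1, le_rfl, fun E hE hE1 => by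
    have := degHom_nonneg hE
    rw [← deg_eq_degHom, hE1] at this
    norm_num at this⟩
  have hmem := Int.csSup_mem hne hbdd
  rw [← hr] at hmem
  refine linSys_nonempty_mono ?_ (hmem.2 (Finsupp.single P (rank D)) (single_nonneg (by omega))
    (by rw [deg_eq_degHom, degHom_single]))
  exact Finsupp.single_mono h

end MetricGraph

/-! ### The Abel–Jacobi map of the theta graph with loops -/

theorem rampSum_add (m m' : ℝ →₀ ℤ) (x : ℝ) : rampSum (m + m') x = rampSum m x + rampSum m' x :=
  Finsupp.sum_add_index' (by simp) (by intros; push_cast; ring)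

theorem rampSum_zero_left (x : ℝ) : rampSum 0 x = 0 := Finsupp.sum_zero_index

theorem mem_of_mem_support_add {m m' : ℝ →₀ ℤ} {S : Set ℝ} (h : ∀ s ∈ m.support, s ∈ S)
    (h' : ∀ s ∈ m'.support, s ∈ S) : ∀ s ∈ (m + m').support, s ∈ S := by
  classical
  intro s hs
  rcases Finset.mem_union.1 (Finsupp.support_add hs) with hs | hs
  exacts [h s hs, h' s hs]

theorem mem_of_mem_support_single {t : ℝ} {k : ℤ} {S : Set ℝ} (h : t ∈ S) :
    ∀ s ∈ (Finsupp.single t k).support, s ∈ S := by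
  intro s hs
  rw [Finset.mem_singleton.1 (Finsupp.support_single_subset hs)]
  exact h

namespace MetricGraph

/-- The lattice of periods of the theta graph, together with the diagonal: the vectors
`(a + bₑ lₑ)ₑ` with `a` real and integers `bₑ` of sum `0`. -/
def periods (l : Fin 3 → ℝ) : AddSubgroup (Fin 3 → ℝ) where
  carrier := {x | ∃ (a : ℝ) (b : Fin 3 → ℤ), ∑ e, b e = 0 ∧ ∀ e, x e = a + b e * l e}
  zero_mem' := ⟨0, 0, by simp⟩
  add_mem' := by
    rintro x y ⟨a, b, hb, hx⟩ ⟨a', b', hb', hy⟩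
    refine ⟨a + a', b + b', by simp [Finset.sum_add_distrib, hb, hb'], fun e => ?_⟩
    simp only [Pi.add_apply, hx, hy]
    push_cast
    ring
  neg_mem' := by
    rintro x ⟨a, b, hb, hx⟩
    refine ⟨-a, -b, by simp [hb], fun e => ?_⟩
    simp only [Pi.neg_apply, hx]
    push_cast
    ring

/-- The Jacobian of the theta graph. The integral flows `b` of the graph are the integer vectors of
sum `0`, so that the dual of the space of flows is `ℝ³` modulo the diagonal; this is divided by the
lattice of the vectors `(bₑ lₑ)ₑ`. -/
abbrev ThetaJac (l : Fin 3 → ℝ) := (Fin 3 → ℝ) ⧸ periods l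

/-- The class of the path of length `t` that starts at `v₁` and runs along the edge `e`. -/
noncomputable def edgeClass (l : Fin 3 → ℝ) (e : Fin 3) : ℝ →+ ThetaJac l :=
  (QuotientAddGroup.mk' (periods l)).comp (AddMonoidHom.single (fun _ : Fin 3 => ℝ) e)

theorem sum_edgeClass (l : Fin 3 → ℝ) (x : Fin 3 → ℝ) :
    ∑ e, edgeClass l e (x e) = QuotientAddGroup.mk' (periods l) x := by
  simp only [edgeClass, AddMonoidHom.comp_apply]
  rw [← map_sum]
  congr 1
  exact Finset.univ_sum_single x

theorem mk_eq_zero_iff {l x : Fin 3 → ℝ} : QuotientAddGroup.mk' (periods l) x = 0 ↔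
    ∃ (a : ℝ) (b : Fin 3 → ℤ), ∑ e, b e = 0 ∧ ∀ e, x e = a + b e * l e :=
  QuotientAddGroup.eq_zero_iff x

theorem sum_edgeClass_const (l : Fin 3 → ℝ) (a : ℝ) : ∑ e, edgeClass l e a = 0 := by
  rw [sum_edgeClass l fun _ => a]
  exact mk_eq_zero_iff.2 ⟨a, 0, by simp⟩

/-- All three edges lead from `v₁` to the same point `v₂`. -/
theorem edgeClass_len (l : Fin 3 → ℝ) (e e' : Fin 3) :
    edgeClass l e (l e) = edgeClass l e' (l e') := by
  rw [← sub_eq_zero]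
  simp only [edgeClass, AddMonoidHom.comp_apply]
  rw [← map_sub]
  refine mk_eq_zero_iff.2 ⟨0, Pi.single e 1 - Pi.single e' 1, by simp, fun i => ?_⟩
  simp only [AddMonoidHom.single_apply, Pi.sub_apply]
  rcases eq_or_ne i e with rfl | h1 <;> rcases eq_or_ne i e' with rfl | h2 <;> simp [*]

/-- The Abel–Jacobi image of a point of the theta graph, with base point `v₁`. -/
noncomputable def thetaClass {l : Fin 3 → ℝ} : ThetaPoint l → ThetaJac l
  | .v₁ => 0
  | .v₂ => edgeClass l 0 (l 0)
  | .inner e t _ => edgeClass l e t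

theorem thetaPt_zero (l : Fin 3 → ℝ) (e : Fin 3) : thetaPt l e 0 = .v₁ := by
  simp [thetaPt]

theorem thetaPt_len {l : Fin 3 → ℝ} (hl : ∀ e, 0 < l e) (e : Fin 3) :
    thetaPt l e (l e) = .v₂ := by
  simp [thetaPt, hl e]

theorem eq_or_eq_or_mem_Ioo {L t : ℝ} (ht : t ∈ Icc 0 L) : t = 0 ∨ t = L ∨ t ∈ Ioo 0 L := by
  rcases ht.1.eq_or_lt with h | h
  · exact Or.inl h.symm
  rcases ht.2.eq_or_lt with h' | h'
  · exact Or.inr (Or.inl h')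
  · exact Or.inr (Or.inr ⟨h, h'⟩)

theorem thetaPt_cases {l : Fin 3 → ℝ} {e : Fin 3} {t : ℝ} (ht : t ∈ Icc 0 (l e)) :
    t = 0 ∨ t = l e ∨ ∃ h : t ∈ Ioo 0 (l e), thetaPt l e t = .inner e t h :=
  (eq_or_eq_or_mem_Ioo ht).imp_right (Or.imp_right fun h => ⟨h, dif_pos h⟩)

theorem thetaClass_thetaPt {l : Fin 3 → ℝ} (hl : ∀ e, 0 < l e) {e : Fin 3} {t : ℝ}
    (ht : t ∈ Icc 0 (l e)) : thetaClass (thetaPt l e t) = edgeClass l e t := by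
  rcases thetaPt_cases ht with rfl | rfl | ⟨h, heq⟩
  · rw [thetaPt_zero, map_zero]
    rfl
  · rw [thetaPt_len hl]
    exact edgeClass_len l 0 e
  · rw [heq]
    rfl

theorem exists_thetaPt {l : Fin 3 → ℝ} (hl : ∀ e, 0 < l e) (P : ThetaPoint l) :
    ∃ e, ∃ t ∈ Icc 0 (l e), thetaPt l e t = P := (theta l hl).pt_surj P

section LoopedTheta

variable {l : Fin 3 → ℝ} {hl : ∀ e, 0 < l e} {ι : Type} [Fintype ι] {q : ι → ThetaPoint l}
  {c : ι → ℝ} {hc : ∀ i, 0 < c i}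

/-- The theta graph with edge lengths `l` and with a loop of length `c i` attached at each `q i`. -/
noncomputable abbrev loopedTheta (hl : ∀ e, 0 < l e) (q : ι → ThetaPoint l) (hc : ∀ i, 0 < c i) :
    MetricGraph := (theta l hl).attachLoops q c hc

/-- The inclusion of the theta graph. -/
def ofTheta (P : ThetaPoint l) : (loopedTheta hl q hc).Point := Sum.inl P

/-- The inclusion of the loops without their base points. -/
def ofLoop (x : Σ i, Ioo 0 (c i)) : (loopedTheta hl q hc).Point := Sum.inr x

/-- The function that is `f` on the theta graph and `g` on the rest of the loops. -/
def glue {A : Type*} (f : ThetaPoint l → A) (g : (Σ i, Ioo 0 (c i)) → A) :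
    (loopedTheta hl q hc).Point → A := Sum.elim f g

@[simp] theorem glue_ofTheta {A : Type*} (f : ThetaPoint l → A) (g : (Σ i, Ioo 0 (c i)) → A)
    (P : ThetaPoint l) : glue f g (ofTheta (hl := hl) (q := q) (hc := hc) P) = f P := rfl

@[simp] theorem glue_ofLoop {A : Type*} (f : ThetaPoint l → A) (g : (Σ i, Ioo 0 (c i)) → A)
    (x : Σ i, Ioo 0 (c i)) : glue f g (ofLoop (hl := hl) (q := q) (hc := hc) x) = g x := rfl

theorem point_cases (P : (loopedTheta hl q hc).Point) :
    (∃ Q, P = ofTheta Q) ∨ ∃ x, P = ofLoop x := by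
  rcases P with Q | x
  · exact Or.inl ⟨Q, rfl⟩
  · exact Or.inr ⟨x, rfl⟩

/-- The point at the parameter `t` of the edge `e` of the theta graph. -/
noncomputable def basePt (hl : ∀ e, 0 < l e) (q : ι → ThetaPoint l) (hc : ∀ i, 0 < c i)
    (e : Fin 3) (t : ℝ) : (loopedTheta hl q hc).Point := ofTheta (thetaPt l e t)

open Classical in
/-- The point at the parameter `t` of the loop `i`. -/
noncomputable def loopPt (hl : ∀ e, 0 < l e) (q : ι → ThetaPoint l) (hc : ∀ i, 0 < c i)
    (i : ι) (t : ℝ) : (loopedTheta hl q hc).Point :=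
  if h : t ∈ Ioo 0 (c i) then ofLoop ⟨i, t, h⟩ else ofTheta (q i)

theorem linEquiv_loopedTheta_iff {D D' : (loopedTheta hl q hc).Divisor} :
    LinEquiv D D' ↔ ∃ (m : Fin 3 → ℝ →₀ ℤ) (n : ι → ℝ →₀ ℤ) (F : (loopedTheta hl q hc).Point → ℝ),
      (∀ e, (∀ s ∈ (m e).support, s ∈ Icc 0 (l e)) ∧ mass (m e) = 0 ∧ ∀ t ∈ Icc 0 (l e),
        F (basePt hl q hc e t) = F (basePt hl q hc e 0) + rampSum (m e) t) ∧
      (∀ i, (∀ s ∈ (n i).support, s ∈ Icc 0 (c i)) ∧ mass (n i) = 0 ∧ ∀ t ∈ Icc 0 (c i),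
        F (loopPt hl q hc i t) = F (loopPt hl q hc i 0) + rampSum (n i) t) ∧
      D' - D = ∑ e, (m e).mapDomain (basePt hl q hc e) +
        ∑ i, (n i).mapDomain (loopPt hl q hc i) := by
  let _ : Fintype (theta l hl).Edge := inferInstanceAs (Fintype (Fin 3))
  let _ : Fintype (loopedTheta hl q hc).Edge := inferInstanceAs (Fintype ((theta l hl).Edge ⊕ ι))
  rw [linEquiv_iff_exists_rampSum]
  constructor
  · rintro ⟨m, F, h, hD⟩
    exact ⟨fun e => m (Sum.inl e), fun i => m (Sum.inr i), F, fun e => h (Sum.inl e),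
      fun i => h (Sum.inr i), hD.trans (Fintype.sum_sum_type
        fun e => (m e).mapDomain ((loopedTheta hl q hc).pt e))⟩
  · rintro ⟨m, n, F, hm, hn, hD⟩
    refine ⟨Sum.elim m n, F, ?_, hD.trans (Fintype.sum_sum_type
        fun e => (Sum.elim m n e).mapDomain ((loopedTheta hl q hc).pt e)).symm⟩
    rintro (e | i)
    · exact hm e
    · exact hn i

open Classical in
/-- The component of the Abel–Jacobi map that belongs to the loop `i`, on points. -/
noncomputable def loopClass (i : ι) : (loopedTheta hl q hc).Point → AddCircle (c i) :=
  glue (fun _ => 0) fun x => if x.1 = i then ((x.2 : ℝ) : AddCircle (c i)) else 0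

/-- The point of the theta graph to which the loops are contracted. -/
def retract : (loopedTheta hl q hc).Point → ThetaPoint l := glue id fun x => q x.1

@[simp] theorem retract_ofTheta (P : ThetaPoint l) :
    retract (ofTheta (hl := hl) (q := q) (hc := hc) P) = P := rfl

@[simp] theorem retract_ofLoop (x : Σ i, Ioo 0 (c i)) :
    retract (ofLoop (hl := hl) (q := q) (hc := hc) x) = q x.1 := rfl

@[simp] theorem loopClass_ofTheta (i : ι) (P : ThetaPoint l) :
    loopClass i (ofTheta (hl := hl) (q := q) (hc := hc) P) = 0 := rfl

theorem loopClass_ofLoop_self (i : ι) (t : Ioo 0 (c i)) :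
    loopClass i (ofLoop (hl := hl) (q := q) (hc := hc) ⟨i, t⟩) = ((t : ℝ) : AddCircle (c i)) :=
  if_pos rfl

theorem loopClass_ofLoop_of_ne {i : ι} {x : Σ i, Ioo 0 (c i)} (h : x.1 ≠ i) :
    loopClass i (ofLoop (hl := hl) (q := q) (hc := hc) x) = 0 := if_neg h

/-- The component of the Abel–Jacobi map with values in the Jacobian of the theta graph. -/
noncomputable def ajTheta : (loopedTheta hl q hc).Divisor →+ ThetaJac l :=
  Finsupp.liftAddHom fun P => zmultiplesHom _ (thetaClass (retract P))

/-- The component of the Abel–Jacobi map with values in the Jacobian of the loop `i`. -/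
noncomputable def ajLoop (i : ι) : (loopedTheta hl q hc).Divisor →+ AddCircle (c i) :=
  Finsupp.liftAddHom fun P => zmultiplesHom _ (loopClass i P)

@[simp] theorem ajTheta_single (P : (loopedTheta hl q hc).Point) (k : ℤ) :
    ajTheta (Finsupp.single P k) = k • thetaClass (retract P) := by
  simp [ajTheta]

@[simp] theorem ajLoop_single (i : ι) (P : (loopedTheta hl q hc).Point) (k : ℤ) :
    ajLoop i (Finsupp.single P k) = k • loopClass i P := by
  simp [ajLoop]

/-- A homomorphism on divisors that is affine along a segment only sees the mass and the moment of a
formal sum on the segment. -/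
theorem map_mapDomain {Γ : MetricGraph} {A : Type*} [AddCommGroup A] (φ : Γ.Divisor →+ A)
    (p : ℝ → Γ.Point) (a : A) (h : ℝ →+ A) {m : ℝ →₀ ℤ}
    (hm : ∀ s ∈ m.support, φ (Finsupp.single (p s) 1) = a + h s) :
    φ (m.mapDomain p) = mass m • a + h (moment m) := by
  have h1 : ∀ s ∈ m.support, φ (Finsupp.single (p s) (m s)) = m s • a + h (m s * s) := by
    intro s hs
    have h2 : Finsupp.single (p s) (m s) = m s • Finsupp.single (p s) (1 : ℤ) := by simp
    rw [h2, map_zsmul, hm s hs, smul_add, ← map_zsmul, zsmul_eq_mul]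
  rw [Finsupp.mapDomain, Finsupp.sum, map_sum, Finset.sum_congr rfl h1, Finset.sum_add_distrib,
    ← Finset.sum_smul, ← map_sum h, mass_eq, moment_eq]

theorem retract_loopPt (i : ι) (t : ℝ) : retract (loopPt hl q hc i t) = q i := by
  unfold loopPt
  split_ifs <;> rfl

theorem loopPt_of_mem {i : ι} {t : ℝ} (h : t ∈ Ioo 0 (c i)) :
    loopPt hl q hc i t = ofLoop ⟨i, t, h⟩ := dif_pos h

theorem loopPt_zero (i : ι) : loopPt hl q hc i 0 = ofTheta (q i) := by
  simp [loopPt]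

theorem loopPt_len (i : ι) : loopPt hl q hc i (c i) = ofTheta (q i) := by
  simp [loopPt]

theorem loopClass_loopPt (i : ι) {t : ℝ} (ht : t ∈ Icc 0 (c i)) :
    loopClass i (loopPt hl q hc i t) = (t : AddCircle (c i)) := by
  rcases eq_or_eq_or_mem_Ioo ht with rfl | rfl | h
  · rw [loopPt_zero]
    rfl
  · rw [loopPt_len, AddCircle.coe_period]
    rfl
  · rw [loopPt_of_mem h]
    exact loopClass_ofLoop_self i ⟨t, h⟩

theorem loopClass_loopPt_of_ne {i j : ι} (h : j ≠ i) (t : ℝ) :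
    loopClass i (loopPt hl q hc j t) = 0 := by
  unfold loopPt
  split_ifs
  · exact loopClass_ofLoop_of_ne h
  · rfl

@[simp] theorem loopClass_basePt (i : ι) (e : Fin 3) (t : ℝ) :
    loopClass i (basePt hl q hc e t) = 0 := rfl

theorem ajTheta_mapDomain_basePt {e : Fin 3} {m : ℝ →₀ ℤ}
    (hm : ∀ s ∈ m.support, s ∈ Icc 0 (l e)) :
    ajTheta (m.mapDomain (basePt hl q hc e)) = edgeClass l e (moment m) := by
  rw [map_mapDomain ajTheta _ 0 (edgeClass l e) fun s hs => ?_]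
  · simp
  · rw [ajTheta_single, one_smul, zero_add]
    exact thetaClass_thetaPt hl (hm s hs)

theorem ajTheta_mapDomain_loopPt (i : ι) (m : ℝ →₀ ℤ) :
    ajTheta (m.mapDomain (loopPt hl q hc i)) = mass m • thetaClass (q i) := by
  rw [map_mapDomain ajTheta _ (thetaClass (q i)) 0 fun s hs => ?_]
  · simp
  · simp [retract_loopPt]

theorem ajLoop_mapDomain_basePt (i : ι) (e : Fin 3) (m : ℝ →₀ ℤ) :
    ajLoop i (m.mapDomain (basePt hl q hc e)) = 0 := by
  rw [map_mapDomain (ajLoop i) _ 0 0 fun s hs => by simp]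
  simp

theorem ajLoop_mapDomain_loopPt_of_ne {i j : ι} (h : j ≠ i) (m : ℝ →₀ ℤ) :
    ajLoop i (m.mapDomain (loopPt hl q hc j)) = 0 := by
  rw [map_mapDomain (ajLoop i) _ 0 0 fun s hs => by simp [loopClass_loopPt_of_ne h]]
  simp

theorem ajLoop_mapDomain_loopPt {i : ι} {m : ℝ →₀ ℤ} (hm : ∀ s ∈ m.support, s ∈ Icc 0 (c i)) :
    ajLoop i (m.mapDomain (loopPt hl q hc i)) = (moment m : AddCircle (c i)) := by
  rw [map_mapDomain (ajLoop i) _ 0 (QuotientAddGroup.mk' _) fun s hs => ?_]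
  · simp
  · rw [ajLoop_single, one_smul, zero_add, loopClass_loopPt i (hm s hs)]
    rfl

theorem ajLoop_sum_mapDomain_loopPt {n : ι → ℝ →₀ ℤ}
    (hn : ∀ i, ∀ s ∈ (n i).support, s ∈ Icc 0 (c i)) (i : ι) :
    ajLoop i (∑ j, (n j).mapDomain (loopPt hl q hc j)) = (moment (n i) : AddCircle (c i)) := by
  classical
  rw [map_sum, Finset.sum_eq_single i (fun j _ hj => ajLoop_mapDomain_loopPt_of_ne hj _)
    (by simp), ajLoop_mapDomain_loopPt (hn i)]

theorem LinEquiv.invariants {D D' : (loopedTheta hl q hc).Divisor} (h : LinEquiv D D') :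
    degHom D' = degHom D ∧ ajTheta D' = ajTheta D ∧ ∀ i, ajLoop i D' = ajLoop i D := by
  obtain ⟨m, n, F, hm, hn, hD⟩ := linEquiv_loopedTheta_iff.1 h
  simp only [← sub_eq_zero (b := degHom D), ← sub_eq_zero (b := ajTheta D),
    ← sub_eq_zero (b := ajLoop _ D), ← map_sub, hD]
  refine ⟨?_, ?_, fun i => ?_⟩
  · simp [degHom_mapDomain, (hm _).2.1, (hn _).2.1]
  · have hmom : ∀ e, moment (m e) = F (ofTheta .v₁) - F (ofTheta .v₂) := by
      intro e
      have h1 := (hm e).2.2 (l e) ⟨(hl e).le, le_rfl⟩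
      simp only [basePt, thetaPt_zero, thetaPt_len hl] at h1
      rw [rampSum_right (hm e).1 (hm e).2.1] at h1
      linarith
    simp [ajTheta_mapDomain_loopPt, (hn _).2.1, ajTheta_mapDomain_basePt (hm _).1, hmom,
      sum_edgeClass_const]
  · have h1 := (hn i).2.2 (c i) ⟨(hc i).le, le_rfl⟩
    rw [rampSum_right (hn i).1 (hn i).2.1, loopPt_zero, loopPt_len] at h1
    have h2 : moment (n i) = 0 := by linarith
    rw [map_add, ajLoop_sum_mapDomain_loopPt (fun i => (hn i).1), h2, map_sum]
    simp [ajLoop_mapDomain_basePt]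

theorem linEquiv_zero_add {D D' : (loopedTheta hl q hc).Divisor} (h : LinEquiv 0 D)
    (h' : LinEquiv 0 D') : LinEquiv 0 (D + D') := by
  obtain ⟨m, n, F, hm, hn, hD⟩ := linEquiv_loopedTheta_iff.1 h
  obtain ⟨m', n', F', hm', hn', hD'⟩ := linEquiv_loopedTheta_iff.1 h'
  refine linEquiv_loopedTheta_iff.2 ⟨m + m', n + n', F + F',
    fun e => ⟨mem_of_mem_support_add (hm e).1 (hm' e).1,
      by simp [(hm e).2.1, (hm' e).2.1], fun t ht => ?_⟩,
    fun i => ⟨mem_of_mem_support_add (hn i).1 (hn' i).1,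
      by simp [(hn i).2.1, (hn' i).2.1], fun t ht => ?_⟩, ?_⟩
  · simp only [Pi.add_apply, rampSum_add, (hm e).2.2 t ht, (hm' e).2.2 t ht]
    ring
  · simp only [Pi.add_apply, rampSum_add, (hn i).2.2 t ht, (hn' i).2.2 t ht]
    ring
  · simp only [sub_zero] at hD hD' ⊢
    simp only [hD, hD', Pi.add_apply, Finsupp.mapDomain_add, Finset.sum_add_distrib]
    abel

/-- On a loop, a formal sum with vanishing mass and moment is principal: its sum of ramps vanishes
at both ends. -/
theorem linEquiv_zero_loop {i : ι} {n : ℝ →₀ ℤ} (hn : ∀ s ∈ n.support, s ∈ Icc 0 (c i))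
    (h0 : mass n = 0) (h1 : moment n = 0) : LinEquiv 0 (n.mapDomain (loopPt hl q hc i)) := by
  classical
  refine linEquiv_loopedTheta_iff.2 ⟨0, Pi.single i n,
    glue (fun _ => 0) (fun x => if x.1 = i then rampSum n x.2 else 0), fun e => ⟨by simp,
      by simp, fun t ht => ?_⟩, fun j => ?_, ?_⟩
  · simp [basePt, rampSum_zero_left]
  · rcases eq_or_ne j i with rfl | hj
    · rw [Pi.single_eq_same]
      refine ⟨hn, h0, fun t ht => ?_⟩
      rw [loopPt_zero, glue_ofTheta]
      rcases eq_or_eq_or_mem_Ioo ht with rfl | rfl | h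
      · rw [loopPt_zero, glue_ofTheta, rampSum_zero hn, add_zero]
      · rw [loopPt_len, glue_ofTheta, rampSum_right hn h0, h1, neg_zero, add_zero]
      · rw [loopPt_of_mem h]
        simp
    · rw [Pi.single_eq_of_ne hj]
      refine ⟨by simp, by simp, fun t ht => ?_⟩
      rw [loopPt_zero, glue_ofTheta, rampSum_zero_left, add_zero]
      unfold loopPt
      split_ifs <;> simp [hj]
  · rw [sub_zero, Finset.sum_eq_single i (fun j _ hj => by rw [Pi.single_eq_of_ne hj]; simp)
      (by simp), Pi.single_eq_same]
    simp

/-- Formal sums of mass `0` and of one and the same moment on the three edges form a principal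
divisor: the three sums of ramps agree at `v₁` and at `v₂`. -/
theorem linEquiv_zero_base {m : Fin 3 → ℝ →₀ ℤ} (hm : ∀ e, ∀ s ∈ (m e).support, s ∈ Icc 0 (l e))
    (h0 : ∀ e, mass (m e) = 0) {a : ℝ} (h1 : ∀ e, moment (m e) = a) :
    LinEquiv 0 (∑ e, (m e).mapDomain (basePt hl q hc e)) := by
  let F₀ : ThetaPoint l → ℝ := fun P => match P with
    | .v₁ => 0
    | .v₂ => -a
    | .inner e t _ => rampSum (m e) t
  refine linEquiv_loopedTheta_iff.2 ⟨m, 0, fun P => F₀ (retract P), fun e => ⟨hm e, h0 e,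
    fun t ht => ?_⟩, fun i => ⟨by simp, by simp, fun t ht => ?_⟩, by simp⟩
  · have hr : ∀ t, retract (basePt hl q hc e t) = thetaPt l e t := fun t => rfl
    simp only [hr, thetaPt_zero]
    change F₀ _ = 0 + _
    rw [zero_add]
    rcases thetaPt_cases ht with rfl | rfl | ⟨h, heq⟩
    · rw [thetaPt_zero, rampSum_zero (hm e)]
    · rw [thetaPt_len hl, rampSum_right (hm e) (h0 e), h1]
    · rw [heq]
  · simp [retract_loopPt, rampSum_zero_left]

theorem exists_eq_sum_mapDomain (D : (loopedTheta hl q hc).Divisor) :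
    ∃ (m : Fin 3 → ℝ →₀ ℤ) (n : ι → ℝ →₀ ℤ), (∀ e, ∀ s ∈ (m e).support, s ∈ Icc 0 (l e)) ∧
      (∀ i, ∀ s ∈ (n i).support, s ∈ Icc 0 (c i)) ∧
      D = ∑ e, (m e).mapDomain (basePt hl q hc e) + ∑ i, (n i).mapDomain (loopPt hl q hc i) := by
  classical
  induction D using Finsupp.induction_linear with
  | zero => exact ⟨0, 0, by simp, by simp, by simp⟩
  | add f g hf hg =>
    obtain ⟨m, n, hm, hn, rfl⟩ := hf
    obtain ⟨m', n', hm', hn', rfl⟩ := hg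
    refine ⟨m + m', n + n', fun e => mem_of_mem_support_add (hm e) (hm' e),
      fun i => mem_of_mem_support_add (hn i) (hn' i), ?_⟩
    simp only [Pi.add_apply, Finsupp.mapDomain_add, Finset.sum_add_distrib]
    abel
  | single P k =>
    rcases point_cases P with ⟨P, rfl⟩ | ⟨⟨i, t, ht⟩, rfl⟩
    · obtain ⟨e, t, ht, rfl⟩ := exists_thetaPt hl P
      refine ⟨Pi.single e (Finsupp.single t k), 0, fun e' => ?_, by simp, ?_⟩
      · rcases eq_or_ne e' e with rfl | h
        · rw [Pi.single_eq_same]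
          exact mem_of_mem_support_single ht
        · simp [Pi.single_eq_of_ne h]
      · rw [Finset.sum_eq_single e (fun j _ hj => by rw [Pi.single_eq_of_ne hj]; simp)
          (by simp), Pi.single_eq_same, Finsupp.mapDomain_single]
        simp [basePt]
    · refine ⟨0, Pi.single i (Finsupp.single t k), by simp, fun j => ?_, ?_⟩
      · rcases eq_or_ne j i with rfl | h
        · rw [Pi.single_eq_same]
          exact mem_of_mem_support_single ⟨ht.1.le, ht.2.le⟩
        · simp [Pi.single_eq_of_ne h]
      · rw [Finset.sum_eq_single i (fun j _ hj => by rw [Pi.single_eq_of_ne hj]; simp)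
          (by simp), Pi.single_eq_same, Finsupp.mapDomain_single, loopPt_of_mem ht]
        simp

end LoopedTheta

end MetricGraph

/-! ### The Abel–Jacobi theorem -/

namespace MetricGraph

section LoopedTheta

variable {l : Fin 3 → ℝ} {hl : ∀ e, 0 < l e} {ι : Type} [Fintype ι] {q : ι → ThetaPoint l}
  {c : ι → ℝ} {hc : ∀ i, 0 < c i}

/-- A divisor of degree `0` whose Abel–Jacobi image vanishes is principal. First the part on each
loop is moved to the base point of the loop. On the theta graph, integral multiples of `v₁` and `v₂`,
of total coefficient `0`, are then distributed over the edges so that every edge gets mass `0` and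
the same moment. -/
theorem linEquiv_zero_of_invariants {D : (loopedTheta hl q hc).Divisor} (h0 : degHom D = 0)
    (h1 : ajTheta D = 0) (h2 : ∀ i, ajLoop i D = 0) : LinEquiv 0 D := by
  classical
  obtain ⟨m, n, hm, hn, hD⟩ := exists_eq_sum_mapDomain D
  have hz : ∀ i, ∃ z : ℤ, z • c i = moment (n i) := fun i => by
    have h := h2 i
    rw [hD, map_add, ajLoop_sum_mapDomain_loopPt hn, map_sum] at h
    simp only [ajLoop_mapDomain_basePt, Finset.sum_const_zero, zero_add] at h
    exact (AddCircle.coe_eq_zero_iff _).1 h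
  choose z hz using hz
  choose ε τ hτ hq using fun i => exists_thetaPt hl (q i)
  let n' : ι → ℝ →₀ ℤ := fun i => n i + (Finsupp.single (c i) (-z i) +
    Finsupp.single 0 (z i - mass (n i)))
  let P : (loopedTheta hl q hc).Divisor := ∑ i, (n' i).mapDomain (loopPt hl q hc i)
  have hP : LinEquiv 0 P := by
    refine Finset.sum_induction _ (fun D => LinEquiv 0 D) (fun _ _ => linEquiv_zero_add) ?_
      fun i _ => linEquiv_zero_loop ?_ ?_ ?_
    · exact linEquiv_loopedTheta_iff.2 ⟨0, 0, 0, by simp [rampSum_zero_left],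
        by simp [rampSum_zero_left], by simp⟩
    · exact mem_of_mem_support_add (hn i) (mem_of_mem_support_add
        (mem_of_mem_support_single ⟨(hc i).le, le_rfl⟩)
        (mem_of_mem_support_single ⟨le_rfl, (hc i).le⟩))
    · simp only [n', map_add, mass_single]
      ring
    · simp [n', ← hz]
  let m₁ : Fin 3 → ℝ →₀ ℤ := fun e =>
    m e + ∑ i with ε i = e, Finsupp.single (τ i) (mass (n i))
  have hm₁ : ∀ e, ∀ s ∈ (m₁ e).support, s ∈ Icc 0 (l e) := by
    refine fun e => mem_of_mem_support_add (hm e) ?_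
    refine Finset.sum_induction _ (fun f : ℝ →₀ ℤ => ∀ s ∈ f.support, s ∈ Icc 0 (l e))
      (fun _ _ => mem_of_mem_support_add) (by simp) fun i hi => ?_
    rw [← (Finset.mem_filter.1 hi).2]
    exact mem_of_mem_support_single (hτ i)
  have hsplit : D = P + ∑ e, (m₁ e).mapDomain (basePt hl q hc e) := by
    have e1 : P = ∑ i, (n i).mapDomain (loopPt hl q hc i) -
        ∑ i, Finsupp.single (ofTheta (q i)) (mass (n i)) := by
      rw [← Finset.sum_sub_distrib]
      refine Finset.sum_congr rfl fun i _ => ?_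
      simp only [n', Finsupp.mapDomain_add, Finsupp.mapDomain_single, loopPt_zero, loopPt_len,
        ← Finsupp.single_add]
      rw [show -z i + (z i - mass (n i)) = -mass (n i) by ring, Finsupp.single_neg,
        sub_eq_add_neg]
    have e2 : ∑ e, (m₁ e).mapDomain (basePt hl q hc e) = ∑ e, (m e).mapDomain (basePt hl q hc e) +
        ∑ i, Finsupp.single (ofTheta (q i)) (mass (n i)) := by
      simp only [m₁, Finsupp.mapDomain_add, Finset.sum_add_distrib]
      congr 1
      rw [← Finset.sum_fiberwise Finset.univ ε]
      refine Finset.sum_congr rfl fun e _ => ?_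
      rw [Finsupp.mapDomain_finsetSum]
      refine Finset.sum_congr rfl fun i hi => ?_
      rw [← (Finset.mem_filter.1 hi).2, Finsupp.mapDomain_single, basePt, hq]
    rw [e1, e2, hD]
    abel
  obtain ⟨hP0, hP1, -⟩ := hP.invariants
  rw [hsplit, map_add, hP0, map_zero, zero_add, map_sum] at h0
  rw [hsplit, map_add, hP1, map_zero, zero_add, map_sum] at h1
  simp only [degHom_mapDomain] at h0
  simp only [ajTheta_mapDomain_basePt (hm₁ _)] at h1
  rw [sum_edgeClass] at h1
  obtain ⟨a, b, hb, hab⟩ := mk_eq_zero_iff.1 h1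
  have hbase := linEquiv_zero_base (hl := hl) (q := q) (hc := hc)
    (m := fun e => m₁ e + (Finsupp.single (l e) (-b e) + Finsupp.single 0 (b e - mass (m₁ e))))
    (fun e => mem_of_mem_support_add (hm₁ e) (mem_of_mem_support_add
        (mem_of_mem_support_single ⟨(hl e).le, le_rfl⟩)
        (mem_of_mem_support_single ⟨le_rfl, (hl e).le⟩)))
    (fun e => by simp only [map_add, mass_single]; ring) (a := a) (by simp [hab])
  have hsame : ∑ e, (m₁ e + (Finsupp.single (l e) (-b e) +
      Finsupp.single 0 (b e - mass (m₁ e)))).mapDomain (basePt hl q hc e) =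
      ∑ e, (m₁ e).mapDomain (basePt hl q hc e) := by
    simp only [Finsupp.mapDomain_add, Finsupp.mapDomain_single, basePt, thetaPt_zero,
      thetaPt_len hl, Finset.sum_add_distrib, ← Finsupp.single_finsetSum]
    simp [hb, h0]
  rw [hsame] at hbase
  rw [hsplit]
  exact linEquiv_zero_add hP hbase

/-- The Abel–Jacobi theorem for the looped theta graph. -/
theorem linEquiv_of_invariants {D D' : (loopedTheta hl q hc).Divisor}
    (h0 : degHom D' = degHom D) (h1 : ajTheta D' = ajTheta D)
    (h2 : ∀ i, ajLoop i D' = ajLoop i D) : LinEquiv D D' :=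
  (linEquiv_zero_of_invariants (D := D' - D) (by simp [h0]) (by simp [h1])
    (by simp [h2])).congr_sub (by simp)

end LoopedTheta

/-! ### Jacobi inversion on the theta graph -/

/-- For real `y` and `l > 0` there are a real number `a` and integers `bₑ` of sum `0` such that all
remainders `yₑ - a - bₑ lₑ` lie in `[0, lₑ]` and one of them vanishes. Here `a` is the largest number
for which the integral parts of `(yₑ - a) / lₑ` have sum at least `0`: the sum of the integral parts
decreases there, so that one of the quotients is an integer. -/
theorem exists_remainders {l : Fin 3 → ℝ} (hl : ∀ e, 0 < l e) (y : Fin 3 → ℝ) :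
    ∃ (a : ℝ) (b : Fin 3 → ℤ), ∑ e, b e = 0 ∧ (∀ e, y e - a - b e * l e ∈ Icc 0 (l e)) ∧
      ∃ e, y e - a - b e * l e = 0 := by
  let N : ℝ → ℤ := fun a => ∑ e, ⌊(y e - a) / l e⌋
  let S : Set ℝ := {a | 0 ≤ N a}
  have hS : S.Nonempty := by
    refine ⟨-∑ e, |y e|, Finset.sum_nonneg fun e _ => Int.floor_nonneg.2 (div_nonneg ?_ (hl e).le)⟩
    have h1 : |y e| ≤ ∑ e, |y e| :=
      Finset.single_le_sum (fun i _ => abs_nonneg (y i)) (Finset.mem_univ e)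
    linarith [neg_abs_le (y e)]
  have hS' : BddAbove S := by
    refine ⟨∑ e, |y e|, fun a ha => ?_⟩
    by_contra! hlt
    have h2 : N a < 0 := by
      refine Finset.sum_neg (fun e _ => Int.floor_lt_zero.2 (div_neg_of_neg_of_pos ?_ (hl e)))
        Finset.univ_nonempty
      have h1 : |y e| ≤ ∑ e, |y e| :=
        Finset.single_le_sum (fun i _ => abs_nonneg (y i)) (Finset.mem_univ e)
      linarith [le_abs_self (y e)]
    exact absurd ha h2.not_ge
  set a := sSup S
  have hcont : ∀ e, ContinuousAt (fun x => (y e - x) / l e) a := fun e => by fun_prop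
  have hle : ∀ᶠ x in 𝓝 a, N x ≤ N a := by
    have : ∀ e, ∀ᶠ x in 𝓝 a, ⌊(y e - x) / l e⌋ ≤ ⌊(y e - a) / l e⌋ := fun e => by
      filter_upwards [(hcont e).eventually_lt_const (Int.lt_floor_add_one _)] with x hx
      exact Int.lt_add_one_iff.1 (Int.floor_lt.2 (by exact_mod_cast hx))
    filter_upwards [eventually_all.2 this] with x hx
    exact Finset.sum_le_sum fun e _ => hx e
  have hge : ∀ᶠ x in 𝓝 a, ∑ e, (⌈(y e - a) / l e⌉ - 1) ≤ N x := by
    have : ∀ e, ∀ᶠ x in 𝓝 a, ⌈(y e - a) / l e⌉ - 1 ≤ ⌊(y e - x) / l e⌋ := fun e => by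
      have h1 : ((⌈(y e - a) / l e⌉ - 1 : ℤ) : ℝ) < (y e - a) / l e := by
        push_cast
        linarith [Int.ceil_lt_add_one ((y e - a) / l e)]
      filter_upwards [(hcont e).eventually_const_lt h1] with x hx
      exact Int.le_floor.2 hx.le
    filter_upwards [eventually_all.2 this] with x hx
    exact Finset.sum_le_sum fun e _ => hx e
  have hNa : 0 ≤ N a := by
    obtain ⟨x, hx, hxS⟩ := ((((isLUB_csSup hS hS').frequently_mem hS).filter_mono
      nhdsWithin_le_nhds).and_eventually hle).exists
    exact le_trans hx hxS
  have hNa' : ∑ e, (⌈(y e - a) / l e⌉ - 1) < 0 := by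
    obtain ⟨x, hx, hxa⟩ := ((hge.filter_mono (nhdsWithin_le_nhds (s := Ioi a))).and
      self_mem_nhdsWithin).exists
    refine hx.trans_lt (not_le.1 fun hxS => ?_)
    exact (le_csSup hS' hxS).not_gt hxa
  have hfc : ∀ e, ⌊(y e - a) / l e⌋ ≤ ⌈(y e - a) / l e⌉ := fun e => Int.floor_le_ceil _
  have hcf : ∀ e, ⌈(y e - a) / l e⌉ ≤ ⌊(y e - a) / l e⌋ + 1 := fun e => Int.ceil_le_floor_add_one _
  have hb : ∃ b : Fin 3 → ℤ, ∑ e, b e = 0 ∧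
      ∀ e, ⌈(y e - a) / l e⌉ - 1 ≤ b e ∧ b e ≤ ⌊(y e - a) / l e⌋ := by
    simp only [N, Fin.sum_univ_three] at hNa hNa'
    generalize hf : (fun e => ⌊(y e - a) / l e⌋) = f at *
    generalize hg : (fun e => ⌈(y e - a) / l e⌉) = g at *
    simp only [funext_iff] at hf hg
    simp only [hf, hg] at *
    have h0 := hcf 0
    have h1 := hcf 1
    have h2 := hcf 2
    have h0' := hfc 0
    have h1' := hfc 1
    have h2' := hfc 2
    -- lowering the integral parts one after the other, the sum passes through `0`
    by_cases c0 : f 0 + f 1 + f 2 = 0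
    · exact ⟨f, by rw [Fin.sum_univ_three, c0], fun e => ⟨by linarith [hcf e], le_rfl⟩⟩
    by_cases c1 : (g 0 - 1) + f 1 + f 2 = 0
    · refine ⟨![g 0 - 1, f 1, f 2], by simpa [Fin.sum_univ_three] using c1, fun e => ?_⟩
      fin_cases e <;> simp <;> omega
    · refine ⟨![g 0 - 1, g 1 - 1, f 2], by simp [Fin.sum_univ_three]; omega, fun e => ?_⟩
      fin_cases e <;> simp <;> omega
  obtain ⟨b, hb0, hb⟩ := hb
  have hdiv : ∀ e, (y e - a) / l e * l e = y e - a := fun e => div_mul_cancel₀ _ (hl e).ne'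
  refine ⟨a, b, hb0, fun e => ⟨?_, ?_⟩, ?_⟩
  · have h1 : (b e : ℝ) ≤ (y e - a) / l e := Int.le_floor.1 (hb e).2
    nlinarith [hdiv e, hl e]
  · have h1 : (y e - a) / l e ≤ b e + 1 := by
      exact_mod_cast Int.ceil_le.1 (by linarith [(hb e).1] : ⌈(y e - a) / l e⌉ ≤ b e + 1)
    nlinarith [hdiv e, hl e]
  · obtain ⟨e, -, he⟩ := Finset.exists_lt_of_sum_lt (hNa'.trans_eq hb0.symm)
    refine ⟨e, le_antisymm ?_ ?_⟩
    · have h1 : (y e - a) / l e ≤ b e := Int.ceil_le.1 (by linarith)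
      nlinarith [hdiv e, hl e]
    · have h1 : (b e : ℝ) ≤ (y e - a) / l e := Int.le_floor.1 (hb e).2
      nlinarith [hdiv e, hl e]

/-- Jacobi inversion for the theta graph: every element of the Jacobian is the Abel–Jacobi image of
an effective divisor of degree `2`. -/
theorem exists_thetaClass_add_eq {l : Fin 3 → ℝ} (hl : ∀ e, 0 < l e) (x : ThetaJac l) :
    ∃ P Q : ThetaPoint l, thetaClass P + thetaClass Q = x := by
  obtain ⟨y, rfl⟩ := QuotientAddGroup.mk'_surjective _ x
  obtain ⟨a, b, hb, hr, e, he⟩ := exists_remainders hl y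
  set r : Fin 3 → ℝ := fun e => y e - a - b e * l e with hrdef
  have hx : QuotientAddGroup.mk' (periods l) y = ∑ e, edgeClass l e (r e) := by
    rw [sum_edgeClass, ← sub_eq_zero, ← map_sub]
    refine mk_eq_zero_iff.2 ⟨a, b, hb, fun e => ?_⟩
    simp only [Pi.sub_apply, hrdef]
    ring
  have hre : r e = 0 := he
  have hcl : ∀ e, thetaClass (thetaPt l e (r e)) = edgeClass l e (r e) := fun e =>
    thetaClass_thetaPt hl (hr e)
  rw [hx, Fin.sum_univ_three]
  simp only [← hcl]
  have h0 : thetaClass (thetaPt l e (r e)) = 0 := by rw [hcl, hre, map_zero]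
  fin_cases e
  · rw [show thetaClass (thetaPt l 0 (r 0)) = 0 from h0, zero_add]
    exact ⟨_, _, rfl⟩
  · rw [show thetaClass (thetaPt l 1 (r 1)) = 0 from h0, add_zero]
    exact ⟨_, _, rfl⟩
  · rw [show thetaClass (thetaPt l 2 (r 2)) = 0 from h0, add_zero]
    exact ⟨_, _, rfl⟩

theorem lt_of_cast_mul_lt {m n : ℤ} {L : ℝ} (hL : 0 < L) (h : (m : ℝ) * L < n * L) : m < n := by
  exact_mod_cast lt_of_mul_lt_mul_right h hL.le

/-! ### Rigid divisors on the theta graph -/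

theorem exists_third_edge {e₁ e₂ : Fin 3} (he : e₁ ≠ e₂) :
    ∃ k, k ≠ e₁ ∧ k ≠ e₂ ∧ ∀ x, x = e₁ ∨ x = e₂ ∨ x = k := by
  revert e₁ e₂
  decide

/-- The real inequalities behind the rigidity of two interior points of different edges: `v` is the
vector of positions of two points of the theta graph, which lie on different edges (first case) or
on the same edge (second case), and it is congruent to `(t₁, t₂, 0)` modulo periods. -/
theorem eq_of_sub_mem_periods {l v : Fin 3 → ℝ} (hl : ∀ e, 0 < l e) {e₁ e₂ k : Fin 3}
    (h12 : e₁ ≠ e₂) (hk₁ : k ≠ e₁) (hk₂ : k ≠ e₂) (hk : ∀ x, x = e₁ ∨ x = e₂ ∨ x = k) {t₁ t₂ : ℝ}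
    (ht₁ : t₁ ∈ Ioo 0 (l e₁)) (ht₂ : t₂ ∈ Ioo 0 (l e₂)) (hv0 : ∀ x, 0 ≤ v x)
    (hv : ((∀ x, v x ≤ l x) ∧ ∃ x, v x = 0) ∨ ∃ e, v e ≤ 2 * l e ∧ ∀ x ≠ e, v x = 0)
    {a : ℝ} {b : Fin 3 → ℤ} (hb : b e₁ + b e₂ + b k = 0) (h₁ : v e₁ - t₁ = a + b e₁ * l e₁)
    (h₂ : v e₂ - t₂ = a + b e₂ * l e₂) (h₃ : v k = a + b k * l k) :
    v e₁ = t₁ ∧ v e₂ = t₂ ∧ v k = 0 := by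
  have cmp := fun (m n : ℤ) (x : Fin 3) => lt_of_cast_mul_lt (m := m) (n := n) (hl x)
  have p₁ := hv0 e₁
  have p₂ := hv0 e₂
  have p₃ := hv0 k
  obtain ⟨t₁0, t₁l⟩ := ht₁
  obtain ⟨t₂0, t₂l⟩ := ht₂
  have l₁ := hl e₁
  have l₂ := hl e₂
  have l₃ := hl k
  rcases lt_trichotomy a 0 with ha | ha | ha
  · have := cmp (-1) (b e₁) e₁ (by push_cast; linarith)
    have := cmp (-1) (b e₂) e₂ (by push_cast; linarith)
    have := cmp 0 (b k) k (by push_cast; linarith)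
    omega
  · have := cmp (-1) (b e₁) e₁ (by push_cast; linarith)
    have := cmp (-1) (b e₂) e₂ (by push_cast; linarith)
    have := cmp (-1) (b k) k (by push_cast; linarith)
    have b₁ : b e₁ = 0 := by omega
    have b₂ : b e₂ = 0 := by omega
    have b₃ : b k = 0 := by omega
    simp only [b₁, b₂, b₃, ha, Int.cast_zero, zero_mul, add_zero] at h₁ h₂ h₃
    exact ⟨by linarith, by linarith, h₃⟩
  · exfalso
    rcases hv with ⟨hvl, x, hx⟩ | ⟨e, he, hne⟩
    · have := cmp (b e₁) 1 e₁ (by push_cast; linarith [hvl e₁])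
      have := cmp (b e₂) 1 e₂ (by push_cast; linarith [hvl e₂])
      have := cmp (b k) 1 k (by push_cast; linarith [hvl k])
      have b₁ : b e₁ = 0 := by omega
      have b₂ : b e₂ = 0 := by omega
      have b₃ : b k = 0 := by omega
      simp only [b₁, b₂, b₃, Int.cast_zero, zero_mul, add_zero] at h₁ h₂ h₃
      rcases hk x with rfl | rfl | rfl <;> linarith
    · rcases hk e with rfl | rfl | rfl
      · have v₂ := hne e₂ h12.symm
        have v₃ := hne k hk₁
        have := cmp (b e) 2 e (by push_cast; linarith)
        have := cmp (b e₂) 0 e₂ (by push_cast; linarith)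
        have := cmp (b k) 0 k (by push_cast; linarith)
        omega
      · have v₁ := hne e₁ h12
        have v₃ := hne k hk₂
        have := cmp (b e) 2 e (by push_cast; linarith)
        have := cmp (b e₁) 0 e₁ (by push_cast; linarith)
        have := cmp (b k) 0 k (by push_cast; linarith)
        omega
      · have v₁ := hne e₁ hk₁.symm
        have v₂ := hne e₂ hk₂.symm
        have := cmp (b e) 2 e (by push_cast; linarith)
        have := cmp (b e₁) 0 e₁ (by push_cast; linarith)
        have := cmp (b e₂) 0 e₂ (by push_cast; linarith)
        omega

/-- Two interior points of different edges of the theta graph form a rigid divisor: every point of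
an equivalent effective divisor is one of the two. -/
theorem eq_or_eq_of_thetaClass_add_eq {l : Fin 3 → ℝ} (hl : ∀ e, 0 < l e) {e₁ e₂ : Fin 3}
    (he : e₁ ≠ e₂) {t₁ t₂ : ℝ} (ht₁ : t₁ ∈ Ioo 0 (l e₁)) (ht₂ : t₂ ∈ Ioo 0 (l e₂))
    {A B : ThetaPoint l} (h : thetaClass A + thetaClass B = edgeClass l e₁ t₁ + edgeClass l e₂ t₂) :
    A = thetaPt l e₁ t₁ ∨ A = thetaPt l e₂ t₂ := by
  obtain ⟨e, s, hs, rfl⟩ := exists_thetaPt hl A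
  obtain ⟨e', s', hs', rfl⟩ := exists_thetaPt hl B
  rw [thetaClass_thetaPt hl hs, thetaClass_thetaPt hl hs', ← sub_eq_zero] at h
  simp only [edgeClass, AddMonoidHom.comp_apply] at h
  rw [← map_add, ← map_add, ← map_sub] at h
  obtain ⟨a, b, hb, hab⟩ := mk_eq_zero_iff.1 h
  obtain ⟨k, hk₁, hk₂, hk⟩ := exists_third_edge he
  have hsum : b e₁ + b e₂ + b k = 0 := by
    rw [← hb, show (Finset.univ : Finset (Fin 3)) = {e₁, e₂, k} from
      (Finset.eq_univ_of_forall fun x => by simpa using hk x).symm,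
      Finset.sum_insert (by simp [he, hk₁.symm]), Finset.sum_insert (by simp [hk₂.symm]),
      Finset.sum_singleton, add_assoc]
  set v : Fin 3 → ℝ := Pi.single e s + Pi.single e' s' with hv
  have hab' : ∀ x, v x - ((Pi.single e₁ t₁ : Fin 3 → ℝ) x +
      (Pi.single e₂ t₂ : Fin 3 → ℝ) x) = a + b x * l x := hab
  have hsingle : ∀ (e : Fin 3) {s : ℝ}, 0 ≤ s → ∀ x, 0 ≤ (Pi.single e s : Fin 3 → ℝ) x :=
    fun e s hs x => by
      rcases eq_or_ne x e with rfl | hx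
      · simpa using hs
      · simp [hx]
  have key := eq_of_sub_mem_periods (v := v) hl he hk₁ hk₂ hk ht₁ ht₂
    (fun x => add_nonneg (hsingle e hs.1 x) (hsingle e' hs'.1 x)) (by
      rcases eq_or_ne e e' with rfl | hne
      · refine Or.inr ⟨e, ?_, fun x hx => by simp [hv, hx]⟩
        simp only [hv, Pi.add_apply, Pi.single_eq_same]
        linarith [hs.2, hs'.2]
      · obtain ⟨j, hj, hj', hcases⟩ := exists_third_edge hne
        refine Or.inl ⟨fun x => ?_, j, by simp [hv, hj, hj']⟩
        rcases hcases x with rfl | rfl | rfl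
        · simpa [hv, hne] using hs.2
        · simpa [hv, hne.symm] using hs'.2
        · simpa [hv, hj, hj'] using (hl x).le) hsum
    (by simpa [he] using hab' e₁) (by simpa [he.symm] using hab' e₂)
    (by simpa [hk₁, hk₂] using hab' k)
  obtain ⟨k₁, k₂, k₃⟩ := key
  have hne : e ≠ e' := by
    rintro rfl
    rcases hk e with rfl | rfl | rfl
    · simp [hv, he.symm] at k₂
      linarith [ht₂.1]
    · simp [hv, he] at k₁
      linarith [ht₁.1]
    · simp [hv, hk₁.symm] at k₁
      linarith [ht₁.1]
  rcases hk e with rfl | rfl | rfl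
  · left
    rw [← k₁]
    simp [hv, hne]
  · right
    rw [← k₂]
    simp [hv, hne]
  · exfalso
    rcases hk e' with rfl | rfl | rfl
    · simp [hv, hk₂.symm, he.symm] at k₂
      linarith [ht₂.1]
    · simp [hv, hk₁.symm, he] at k₁
      linarith [ht₁.1]
    · exact hne rfl

end MetricGraph

/-! ### Divisors of degree four -/

namespace MetricGraph

section LoopedTheta

variable {l : Fin 3 → ℝ} {hl : ∀ e, 0 < l e} {ι : Type} [Fintype ι] {q : ι → ThetaPoint l}
  {c : ι → ℝ} {hc : ∀ i, 0 < c i}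

theorem coe_ne_zero_of_mem_Ioo {L t : ℝ} (ht : t ∈ Ioo 0 L) : (t : AddCircle L) ≠ 0 := by
  intro h
  obtain ⟨n, hn⟩ := (AddCircle.coe_eq_zero_iff L).1 h
  rw [zsmul_eq_mul] at hn
  have hL : 0 < L := ht.1.trans ht.2
  have h1 : 0 < n := lt_of_cast_mul_lt hL (by push_cast; linarith [ht.1])
  have h2 : n < 1 := lt_of_cast_mul_lt hL (by push_cast; linarith [ht.2])
  omega

theorem loopClass_ofLoop_ne_zero {i : ι} {x : Σ i, Ioo 0 (c i)} (h : x.1 = i) :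
    loopClass i (ofLoop (hl := hl) (q := q) (hc := hc) x) ≠ 0 := by
  subst h
  rw [loopClass_ofLoop_self]
  exact coe_ne_zero_of_mem_Ioo x.2.2

/-- The reflection of every loop; it fixes the theta graph. -/
noncomputable def reflect (P : (loopedTheta hl q hc).Point) : (loopedTheta hl q hc).Point :=
  glue ofTheta (fun x => loopPt hl q hc x.1 (c x.1 - x.2)) P

theorem retract_reflect (P : (loopedTheta hl q hc).Point) : retract (reflect P) = retract P := by
  rcases point_cases P with ⟨Q, rfl⟩ | ⟨x, rfl⟩
  · rfl
  · simp [reflect, retract_loopPt]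

theorem loopClass_reflect (i : ι) (P : (loopedTheta hl q hc).Point) :
    loopClass i (reflect P) = - loopClass i P := by
  rcases point_cases P with ⟨Q, rfl⟩ | ⟨⟨j, t, ht⟩, rfl⟩
  · simp [reflect]
  · simp only [reflect, glue_ofLoop]
    rcases eq_or_ne j i with rfl | h
    · rw [loopClass_loopPt j ⟨by linarith [ht.2], by linarith [ht.1]⟩, loopClass_ofLoop_self]
      simp
    · rw [loopClass_loopPt_of_ne h, loopClass_ofLoop_of_ne h, neg_zero]

/-- A non-trivial component at a loop can only come from a point inside this loop, and such a point
is retracted to the base point of the loop. -/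
theorem exists_sub_of_ajLoop_ne_zero {A : (loopedTheta hl q hc).Divisor} (hA : 0 ≤ A)
    {S : Finset ι} (hS : ∀ i ∈ S, ajLoop i A ≠ 0) :
    ∃ B : (loopedTheta hl q hc).Divisor, 0 ≤ B ∧ degHom B = degHom A - S.card ∧
      ajTheta A = ∑ i ∈ S, thetaClass (q i) + ajTheta B := by
  classical
  induction S using Finset.induction_on generalizing A with
  | empty => exact ⟨A, hA, by simp, by simp⟩
  | insert i S hi ih =>
    obtain ⟨P, hP, hPi⟩ : ∃ P ∈ A.support, loopClass i P ≠ 0 := by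
      by_contra! h
      refine hS i (Finset.mem_insert_self i S) ?_
      have h1 : ajLoop i A = ∑ P ∈ A.support, A P • loopClass i P := rfl
      rw [h1]
      exact Finset.sum_eq_zero fun P hP => by rw [h P hP, smul_zero]
    rcases point_cases P with ⟨Q, rfl⟩ | ⟨x, rfl⟩
    · exact absurd (loopClass_ofTheta i Q) hPi
    have hx : x.1 = i := by
      by_contra h
      exact hPi (loopClass_ofLoop_of_ne h)
    have hle := single_le_of_pos hA
      (lt_of_le_of_ne (hA _) (Ne.symm (Finsupp.mem_support_iff.1 hP)))
    obtain ⟨B, hB, hBd, hBt⟩ := ih (sub_nonneg.2 hle) fun j hj => by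
      have hne : x.1 ≠ j := by
        rw [hx]
        rintro rfl
        exact hi hj
      rw [map_sub, ajLoop_single, loopClass_ofLoop_of_ne hne, smul_zero, sub_zero]
      exact hS j (Finset.mem_insert_of_mem hj)
    refine ⟨B, hB, ?_, ?_⟩
    · rw [hBd, map_sub, degHom_single, Finset.card_insert_of_notMem hi]
      push_cast
      ring
    · rw [map_sub, sub_eq_iff_eq_add, ajTheta_single, one_smul, retract_ofLoop, hx] at hBt
      rw [hBt, Finset.sum_insert hi]
      abel

theorem exists_of_linSys_nonempty {D : (loopedTheta hl q hc).Divisor} (hD : (linSys D).Nonempty)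
    {S : Finset ι} (hS : ∀ i ∈ S, ajLoop i D ≠ 0) :
    ∃ B : (loopedTheta hl q hc).Divisor, 0 ≤ B ∧ degHom B = degHom D - S.card ∧
      ajTheta D = ∑ i ∈ S, thetaClass (q i) + ajTheta B := by
  obtain ⟨A, hA, hDA⟩ := hD
  obtain ⟨h0, h1, h2⟩ := hDA.invariants
  rw [← h0, ← h1]
  exact exists_sub_of_ajLoop_ne_zero hA fun i hi => by rw [h2]; exact hS i hi

theorem ajTheta_eq_of_linSys_nonempty {D : (loopedTheta hl q hc).Divisor}
    (hD : (linSys D).Nonempty) {S : Finset ι} (hS : ∀ i ∈ S, ajLoop i D ≠ 0)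
    (hd : degHom D = S.card) : ajTheta D = ∑ i ∈ S, thetaClass (q i) := by
  obtain ⟨B, hB, hBd, hBt⟩ := exists_of_linSys_nonempty hD hS
  rw [hBt, eq_zero_of_degHom_eq_zero hB (by omega), map_zero, add_zero]

theorem exists_ajTheta_eq_of_linSys_nonempty {D : (loopedTheta hl q hc).Divisor}
    (hD : (linSys D).Nonempty) {S : Finset ι} (hS : ∀ i ∈ S, ajLoop i D ≠ 0)
    (hd : degHom D = S.card + 1) :
    ∃ W : ThetaPoint l, ajTheta D = ∑ i ∈ S, thetaClass (q i) + thetaClass W := by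
  obtain ⟨B, hB, hBd, hBt⟩ := exists_of_linSys_nonempty hD hS
  obtain ⟨P, rfl⟩ := exists_eq_single hB (by omega)
  exact ⟨retract P, by rw [hBt, ajTheta_single, one_smul]⟩

/-- A divisor of degree `4` without components at the loops has rank at least `1`: by Jacobi
inversion there is a divisor `P₁ + P₂ + P'` in `|D - P|`, where `P'` is the reflection of `P`. -/
theorem linSys_sub_single_nonempty {D : (loopedTheta hl q hc).Divisor} (hd : degHom D = 4)
    (hloop : ∀ i, ajLoop i D = 0) (P : (loopedTheta hl q hc).Point) :
    (linSys (D - Finsupp.single P 1)).Nonempty := by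
  obtain ⟨P₁, P₂, h⟩ := exists_thetaClass_add_eq hl
    (ajTheta D - thetaClass (retract P) - thetaClass (retract P))
  refine ⟨Finsupp.single (ofTheta P₁) 1 + Finsupp.single (ofTheta P₂) 1 +
    Finsupp.single (reflect P) 1, ?_, linEquiv_of_invariants ?_ ?_ fun i => ?_⟩
  · exact add_nonneg (add_nonneg (single_nonneg zero_le_one) (single_nonneg zero_le_one))
      (single_nonneg zero_le_one)
  · simp [hd]
  · simp [retract_reflect, h]
  · simp [loopClass_reflect, hloop]

/-- The midpoint of the loop `i`. -/
noncomputable def loopMid (hl : ∀ e, 0 < l e) (q : ι → ThetaPoint l) (hc : ∀ i, 0 < c i) (i : ι) :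
    (loopedTheta hl q hc).Point := loopPt hl q hc i (c i / 2)

@[simp] theorem retract_loopMid (i : ι) : retract (loopMid hl q hc i) = q i := retract_loopPt i _

theorem loopClass_loopMid_of_ne {i j : ι} (h : j ≠ i) : loopClass i (loopMid hl q hc j) = 0 :=
  loopClass_loopPt_of_ne h _

theorem loopClass_loopMid_ne_zero (i : ι) : loopClass i (loopMid hl q hc i) ≠ 0 := by
  have := hc i
  rw [loopMid, loopClass_loopPt i ⟨by linarith, by linarith⟩]
  exact coe_ne_zero_of_mem_Ioo ⟨by linarith, by linarith⟩

theorem ajTheta_eq_of_linSys_sub_loopMid {D : (loopedTheta hl q hc).Divisor} (hd : degHom D = 4)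
    (hloop : ∀ i, ajLoop i D = 0) {i j : ι} (hij : i ≠ j)
    (h : (linSys (D - (Finsupp.single (loopMid hl q hc i) 1 +
      Finsupp.single (loopMid hl q hc j) 1))).Nonempty) :
    ajTheta D = thetaClass (q i) + thetaClass (q i) + (thetaClass (q j) + thetaClass (q j)) := by
  classical
  have h1 := ajTheta_eq_of_linSys_nonempty h (S := {i, j}) (by
    intro k hk
    rw [Finset.mem_insert, Finset.mem_singleton] at hk
    rcases hk with rfl | rfl
    · simp [hloop, loopClass_loopMid_of_ne hij.symm, loopClass_loopMid_ne_zero]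
    · simp [hloop, loopClass_loopMid_of_ne hij, loopClass_loopMid_ne_zero])
    (by simp [hd, Finset.card_pair hij])
  rw [Finset.sum_pair hij] at h1
  simp only [map_sub, map_add, ajTheta_single, one_smul, retract_loopMid, sub_eq_iff_eq_add] at h1
  rw [h1]
  abel

theorem rank_eq_one_of_ajLoop_eq_zero {D : (loopedTheta hl q hc).Divisor} (hd : degHom D = 4)
    (hloop : ∀ i, ajLoop i D = 0) {i j k : ι} (hik : i ≠ k) (hjk : j ≠ k)
    (hne : thetaClass (q i) + thetaClass (q i) ≠ thetaClass (q j) + thetaClass (q j)) :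
    rank D = 1 := by
  have hE : ∀ i, (0 : (loopedTheta hl q hc).Divisor) ≤ Finsupp.single (loopMid hl q hc i) 1 +
      Finsupp.single (loopMid hl q hc k) 1 := fun i =>
    add_nonneg (single_nonneg zero_le_one) (single_nonneg zero_le_one)
  have h1 := linSys_sub_single_nonempty hd hloop
  by_cases h : (linSys (D - (Finsupp.single (loopMid hl q hc i) 1 +
      Finsupp.single (loopMid hl q hc k) 1))).Nonempty
  · refine rank_eq_one h1 (hE j) (by simp) fun h' => hne ?_
    have := (ajTheta_eq_of_linSys_sub_loopMid hd hloop hik h).symm.trans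
      (ajTheta_eq_of_linSys_sub_loopMid hd hloop hjk h')
    exact add_right_cancel this
  · exact rank_eq_one h1 (hE i) (by simp) h

/-- Two arbitrary points, together with their reflections, form a `g¹₄`. -/
theorem exists_isG_of_points {i j k : ι} (hik : i ≠ k) (hjk : j ≠ k)
    (hne : thetaClass (q i) + thetaClass (q i) ≠ thetaClass (q j) + thetaClass (q j))
    (v₁ v₂ : (loopedTheta hl q hc).Point) : ∃ D : (loopedTheta hl q hc).Divisor, 0 ≤ D ∧
      IsG 1 4 D ∧ Finsupp.single v₁ 1 + Finsupp.single v₂ 1 ≤ D := by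
  have h0 : ∀ P, (0 : (loopedTheta hl q hc).Divisor) ≤ Finsupp.single P 1 := fun P =>
    single_nonneg zero_le_one
  refine ⟨Finsupp.single v₁ 1 + Finsupp.single v₂ 1 +
    (Finsupp.single (reflect v₁) 1 + Finsupp.single (reflect v₂) 1),
    add_nonneg (add_nonneg (h0 _) (h0 _)) (add_nonneg (h0 _) (h0 _)), ⟨?_, ?_⟩,
    le_add_of_nonneg_right (add_nonneg (h0 _) (h0 _))⟩
  · simp [deg_eq_degHom]
  · refine rank_eq_one_of_ajLoop_eq_zero (by simp) (fun i => ?_) hik hjk hne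
    simp only [map_add, ajLoop_single, loopClass_reflect, one_smul]
    abel

theorem thetaPt_injOn {e e' : Fin 3} {t t' : ℝ} (ht : t ∈ Ioo 0 (l e)) (ht' : t' ∈ Ioo 0 (l e'))
    (h : thetaPt l e t = thetaPt l e' t') : e = e' ∧ t = t' := by
  rw [thetaPt, thetaPt, dif_pos ht, dif_pos ht'] at h
  cases h
  exact ⟨rfl, rfl⟩

theorem edgeClass_add_reflect (e : Fin 3) (t : ℝ) :
    edgeClass l e t + edgeClass l e (l e - t) = edgeClass l 0 (l 0) := by
  rw [← map_add, add_sub_cancel, edgeClass_len l e 0]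

end LoopedTheta

/-- Twice a point that is not the midpoint of its edge is not a canonical divisor. -/
theorem edgeClass_add_self_ne {l : Fin 3 → ℝ} (hl : ∀ e, 0 < l e) {t : ℝ} (ht : t ∈ Ioo 0 (l 1))
    (hne : t ≠ l 1 / 2) : edgeClass l 1 t + edgeClass l 1 t ≠ edgeClass l 0 (l 0) := by
  intro h
  have ht' : l 1 - t ∈ Ioo 0 (l 1) := ⟨by linarith [ht.2], by linarith [ht.1]⟩
  have hm : l 2 / 2 ∈ Ioo 0 (l 2) := ⟨by linarith [hl 2], by linarith [hl 2]⟩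
  rw [← edgeClass_add_reflect 1 t] at h
  have h' := add_left_cancel h
  rcases eq_or_eq_of_thetaClass_add_eq hl (by decide) ht hm (A := thetaPt l 1 (l 1 - t))
    (B := thetaPt l 2 (l 2 / 2)) (by
      rw [thetaClass_thetaPt hl ⟨ht'.1.le, ht'.2.le⟩, thetaClass_thetaPt hl ⟨hm.1.le, hm.2.le⟩, h'])
    with h1 | h1
  · exact hne (by linarith [(thetaPt_injOn ht' ht h1).2])
  · exact absurd (thetaPt_injOn ht' hm h1).1 (by decide)

end MetricGraph

/-! ### A divisor of degree three that lies in no pencil of degree four -/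

namespace MetricGraph

section LoopedTheta

variable {l : Fin 3 → ℝ} {hl : ∀ e, 0 < l e} {ι : Type} [Fintype ι] {q : ι → ThetaPoint l}
  {c : ι → ℝ} {hc : ∀ i, 0 < c i}

/-- The effective divisor of degree `3` that is not contained in any `g¹₄`: the midpoints of the
loops at `q i₀` and `q i₁`, and the mirror image of `q i₁` on its edge of the theta graph. If the
fourth point `y` of a divisor of degree `4` and rank at least `1` does not lie on the loop at `q i₂`,
then subtracting a point of this loop forces every effective representative to have points on
several loops, and an equation in the Jacobian results that contradicts rigidity; if `y` lies on the
loop at `q i₂`, then the same happens on subtracting a point of the loop at `q i₁`. -/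
theorem not_le_of_one_le_rank {i₀ i₁ i₂ : ι} (h01 : i₀ ≠ i₁) (h02 : i₀ ≠ i₂) (h12 : i₁ ≠ i₂)
    (hq0 : q i₀ = thetaPt l 0 (l 0 / 2)) {t₁ t₂ : ℝ} (ht₁ : t₁ ∈ Ioo 0 (l 1))
    (ht₂ : t₂ ∈ Ioo 0 (l 2)) (hq1 : q i₁ = thetaPt l 1 t₁) (hq2 : q i₂ = thetaPt l 2 t₂)
    (hm₁ : t₁ ≠ l 1 / 2) (hm₂ : t₂ ≠ l 2 / 2) {E : (loopedTheta hl q hc).Divisor}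
    (hE : degHom E = 4) (hr : 1 ≤ rank E) :
    ¬ Finsupp.single (loopMid hl q hc i₀) 1 + Finsupp.single (loopMid hl q hc i₁) 1 +
      Finsupp.single (basePt hl q hc 1 (l 1 - t₁)) 1 ≤ E := by
  classical
  intro hle
  obtain ⟨y, hy⟩ := exists_eq_single (sub_nonneg.2 hle) (by simp [hE])
  obtain rfl := sub_eq_iff_eq_add.1 hy
  have hlin := linSys_nonempty_of_one_le_rank hr
  -- the mirror images of `q i₁` and `q i₂`
  have ht₁' : l 1 - t₁ ∈ Ioo 0 (l 1) := ⟨by linarith [ht₁.2], by linarith [ht₁.1]⟩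
  have ht₂' : l 2 - t₂ ∈ Ioo 0 (l 2) := ⟨by linarith [ht₂.2], by linarith [ht₂.1]⟩
  have cl₁ : thetaClass (q i₁) = edgeClass l 1 t₁ := by
    rw [hq1, thetaClass_thetaPt hl ⟨ht₁.1.le, ht₁.2.le⟩]
  have cl₂ : thetaClass (q i₂) = edgeClass l 2 t₂ := by
    rw [hq2, thetaClass_thetaPt hl ⟨ht₂.1.le, ht₂.2.le⟩]
  have cl₁' : thetaClass (thetaPt l 1 (l 1 - t₁)) = edgeClass l 1 (l 1 - t₁) :=
    thetaClass_thetaPt hl ⟨ht₁'.1.le, ht₁'.2.le⟩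
  have cl₂' : thetaClass (thetaPt l 2 (l 2 - t₂)) = edgeClass l 2 (l 2 - t₂) :=
    thetaClass_thetaPt hl ⟨ht₂'.1.le, ht₂'.2.le⟩
  have k₀ : thetaClass (q i₀) + thetaClass (q i₀) = edgeClass l 0 (l 0) := by
    have := hl 0
    rw [hq0, thetaClass_thetaPt hl ⟨by linarith, by linarith⟩, ← map_add, add_halves]
  have k₁ := edgeClass_add_reflect (l := l) 1 t₁
  have k₂ := edgeClass_add_reflect (l := l) 2 t₂
  have hz : retract (basePt hl q hc 1 (l 1 - t₁)) = thetaPt l 1 (l 1 - t₁) := rfl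
  have hmid := loopClass_loopMid_ne_zero (hl := hl) (q := q) (hc := hc)
  have hmid' : ∀ {i j : ι}, j ≠ i → loopClass i (loopMid hl q hc j) = 0 :=
    loopClass_loopMid_of_ne
  have ne12 : (1 : Fin 3) ≠ 2 := by decide
  rcases point_cases y with ⟨Y, rfl⟩ | ⟨x, rfl⟩
  -- `y` on the theta graph: with `'` for mirror images, `q₂' + y ~ q₁ + q₂`
  · have h := ajTheta_eq_of_linSys_nonempty (hlin (loopMid hl q hc i₂)) (S := {i₀, i₁, i₂}) (by
      simp only [Finset.mem_insert, Finset.mem_singleton, forall_eq_or_imp, forall_eq]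
      simp [hmid', h01, h02, h12, h01.symm, h02.symm, h12.symm, hmid]) (by
      simp [h01, h02, h12])
    rw [Finset.sum_insert (by simp [h01, h02]), Finset.sum_pair h12] at h
    simp only [map_sub, map_add, ajTheta_single, one_smul, retract_loopMid, retract_ofTheta, hz,
      cl₁, cl₂, cl₁'] at h
    have key : thetaClass (thetaPt l 2 (l 2 - t₂)) + thetaClass Y =
        edgeClass l 1 t₁ + edgeClass l 2 t₂ := by
      rw [cl₂']
      grind
    rcases eq_or_eq_of_thetaClass_add_eq hl ne12 ht₁ ht₂ key with h1 | h1
    · exact ne12 (thetaPt_injOn ht₂' ht₁ h1).1.symm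
    · exact hm₂ (by linarith [(thetaPt_injOn ht₂' ht₂ h1).2])
  -- `y` on the loop at `q₂`: `2 q₁` would be canonical; the point `c₁ / 4` is not the midpoint of
  -- the loop at `q₁`, so that this loop keeps a non-trivial component
  by_cases hx2 : x.1 = i₂
  · have hp : (c i₁ / 4) ∈ Ioo 0 (c i₁) := ⟨by linarith [hc i₁], by linarith [hc i₁]⟩
    have hp1 : loopClass i₁ (loopMid hl q hc i₁) - loopClass i₁ (loopPt hl q hc i₁ (c i₁ / 4)) ≠
        0 := by
      rw [loopMid, loopClass_loopPt i₁ ⟨hp.1.le, hp.2.le⟩,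
        loopClass_loopPt i₁ ⟨by linarith [hc i₁], by linarith [hc i₁]⟩, ← AddCircle.coe_sub]
      exact coe_ne_zero_of_mem_Ioo ⟨by linarith [hc i₁], by linarith [hc i₁]⟩
    have h := ajTheta_eq_of_linSys_nonempty (hlin (loopPt hl q hc i₁ (c i₁ / 4)))
      (S := {i₀, i₁, i₂}) (by
      simp only [Finset.mem_insert, Finset.mem_singleton, forall_eq_or_imp, forall_eq]
      simp [hmid', h01, h02, h12, h01.symm, h02.symm, h12.symm, hmid, hp1,
        loopClass_ofLoop_ne_zero hx2, loopClass_loopPt_of_ne, loopClass_ofLoop_of_ne, hx2]) (by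
      simp [h01, h02, h12])
    rw [Finset.sum_insert (by simp [h01, h02]), Finset.sum_pair h12] at h
    simp only [map_sub, map_add, ajTheta_single, one_smul, retract_loopMid, retract_ofLoop, hz,
      retract_loopPt, hx2, cl₁, cl₂, cl₁'] at h
    exact edgeClass_add_self_ne hl ht₁ hm₁ (by grind)
  -- `y` on the loop at `q₀`: `q₂ + W ~ q₁' + q₂'` for some point `W`
  by_cases hx0 : x.1 = i₀
  · obtain ⟨W, h⟩ := exists_ajTheta_eq_of_linSys_nonempty (hlin (loopMid hl q hc i₂))
      (S := {i₁, i₂}) (by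
      simp only [Finset.mem_insert, Finset.mem_singleton, forall_eq_or_imp, forall_eq]
      simp [hmid', h01, h02, h12, h12.symm, hmid, loopClass_ofLoop_of_ne, hx0])
      (by simp [h12])
    rw [Finset.sum_pair h12] at h
    simp only [map_sub, map_add, ajTheta_single, one_smul, retract_loopMid, retract_ofLoop, hz,
      hx0, cl₁, cl₂, cl₁'] at h
    have key : thetaClass (q i₂) + thetaClass W =
        edgeClass l 1 (l 1 - t₁) + edgeClass l 2 (l 2 - t₂) := by
      rw [cl₂]
      grind
    rcases eq_or_eq_of_thetaClass_add_eq hl ne12 ht₁' ht₂' key with h1 | h1 <;> rw [hq2] at h1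
    · exact ne12 (thetaPt_injOn ht₂ ht₁' h1).1.symm
    · exact hm₂ (by linarith [(thetaPt_injOn ht₂ ht₂' h1).2])
  -- `y` on the loop at `q₁`: `q₂ + W ~ q₁ + q₂'` for some point `W`
  by_cases hx1 : x.1 = i₁
  · obtain ⟨W, h⟩ := exists_ajTheta_eq_of_linSys_nonempty (hlin (loopMid hl q hc i₂))
      (S := {i₀, i₂}) (by
      simp only [Finset.mem_insert, Finset.mem_singleton, forall_eq_or_imp, forall_eq]
      simp [hmid', h02, h12, h01.symm, h02.symm, hmid, loopClass_ofLoop_of_ne, hx1])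
      (by simp [h02])
    rw [Finset.sum_pair h02] at h
    simp only [map_sub, map_add, ajTheta_single, one_smul, retract_loopMid, retract_ofLoop, hz,
      hx1, cl₁, cl₂, cl₁'] at h
    have key : thetaClass (q i₂) + thetaClass W =
        edgeClass l 1 t₁ + edgeClass l 2 (l 2 - t₂) := by
      rw [cl₂]
      grind
    rcases eq_or_eq_of_thetaClass_add_eq hl ne12 ht₁ ht₂' key with h1 | h1 <;> rw [hq2] at h1
    · exact ne12 (thetaPt_injOn ht₂ ht₁ h1).1.symm
    · exact hm₂ (by linarith [(thetaPt_injOn ht₂ ht₂' h1).2])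
  -- `y` on another loop: there would be an effective divisor of degree `3` with points on four loops
  · obtain ⟨B, hB, hBd, -⟩ := exists_of_linSys_nonempty (hlin (loopMid hl q hc i₂))
      (S := {i₀, i₁, i₂, x.1}) (by
      simp only [Finset.mem_insert, Finset.mem_singleton, forall_eq_or_imp, forall_eq]
      simp [hmid', h01, h02, h12, h01.symm, h02.symm, h12.symm, hmid, loopClass_ofLoop_of_ne,
        hx0, hx1, hx2, Ne.symm hx0, Ne.symm hx1, Ne.symm hx2, loopClass_ofLoop_ne_zero])
    have := degHom_nonneg hB
    rw [hBd] at this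
    simp [h01, h02, h12, Ne.symm hx0, Ne.symm hx1, Ne.symm hx2] at this

end LoopedTheta

end MetricGraph

theorem proposition2 (n : ℕ) (hn : 2 ≤ n)
    (l : Fin 3 → ℝ) (hl : ∀ e, 0 < l e) (hl_inj : Function.Injective l)
    (q : Fin (n + 1) → (MetricGraph.theta l hl).Point) (hq_inj : Function.Injective q)
    (hq0 : q ⟨0, by omega⟩ = MetricGraph.thetaPt l 0 (l 0 / 2))
    (hq1 : ∃ t, 0 < t ∧ t < l 1 / 2 ∧ q ⟨1, by omega⟩ = MetricGraph.thetaPt l 1 t)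
    (hq2 : ∃ t, l 2 / 2 < t ∧ t < l 2 ∧ q ⟨2, by omega⟩ = MetricGraph.thetaPt l 2 t)
    (c : Fin (n + 1) → ℝ) (hc : ∀ i, 0 < c i)
    (G : MetricGraph) (hG : G = (MetricGraph.theta l hl).attachLoops q c hc) :
    G.w 1 4 = 1 ∧
    ∀ v₁ v₂ : G.Point, ∃ D : G.Divisor, MetricGraph.IsG 1 4 D ∧
      ∃ E ∈ MetricGraph.linSys D, Finsupp.single v₁ 1 + Finsupp.single v₂ 1 ≤ E := by
  open MetricGraph in
  subst hG
  obtain ⟨t₁, h1a, h1b, hq1⟩ := hq1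
  obtain ⟨t₂, h2a, h2b, hq2⟩ := hq2
  have := hl 0
  have ht₁ : t₁ ∈ Ioo 0 (l 1) := ⟨h1a, by linarith [hl 1]⟩
  have ht₂ : t₂ ∈ Ioo 0 (l 2) := ⟨by linarith [hl 2], h2b⟩
  have hne : thetaClass (q ⟨1, by omega⟩) + thetaClass (q ⟨1, by omega⟩) ≠
      thetaClass (q ⟨0, by omega⟩) + thetaClass (q ⟨0, by omega⟩) := by
    rw [hq0, hq1, thetaClass_thetaPt hl ⟨ht₁.1.le, ht₁.2.le⟩,
      thetaClass_thetaPt hl (e := 0) ⟨by linarith, by linarith⟩, ← map_add (edgeClass l 0),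
      add_halves]
    exact edgeClass_add_self_ne hl ht₁ h1b.ne
  have hpts := exists_isG_of_points (hl := hl) (q := q) (hc := hc) (i := ⟨1, by omega⟩)
    (j := ⟨0, by omega⟩) (k := ⟨2, by omega⟩) (by simp) (by simp) hne
  refine ⟨?_, fun v₁ v₂ => ?_⟩
  · obtain ⟨D, -, hD, -⟩ := hpts (ofTheta .v₁) (ofTheta .v₁)
    rw [w, if_pos ⟨D, hD⟩]
    refine IsGreatest.csSup_eq ⟨⟨zero_le_one, fun F hF hF2 => ?_⟩, fun k hk => ?_⟩
    · rw [deg_eq_degHom] at hF2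
      push_cast at hF2
      obtain ⟨v₁, hv₁⟩ := exists_single_le hF (by omega)
      obtain ⟨v₂, hv₂⟩ := exists_eq_single (sub_nonneg.2 hv₁)
        (by rw [map_sub, hF2, degHom_single]; norm_num)
      obtain ⟨E, hE, hEG, hle⟩ := hpts v₁ v₂
      refine ⟨E, hE, hEG.1, hEG.2.ge, ?_⟩
      rwa [sub_eq_iff_eq_add'.1 hv₂]
    · by_contra! hk1
      have hs : ∀ P, (0 : (loopedTheta hl q hc).Divisor) ≤ Finsupp.single P 1 := fun P =>
        single_nonneg zero_le_one
      have hF := add_nonneg (add_nonneg (hs (loopMid hl q hc ⟨0, by omega⟩))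
        (hs (loopMid hl q hc ⟨1, by omega⟩))) (hs (basePt hl q hc 1 (l 1 - t₁)))
      have hA : (0 : (loopedTheta hl q hc).Divisor) ≤ Finsupp.single (ofTheta .v₁) (k - 2) :=
        single_nonneg (by omega)
      obtain ⟨E, hE, hEd, hEr, hle⟩ := hk.2 _ (add_nonneg hF hA) (by
        simp only [deg_eq_degHom, map_add, degHom_single]
        push_cast
        ring)
      refine not_le_of_one_le_rank (by simp) (by simp) (by simp) hq0 ht₁ ht₂ hq1 hq2 h1b.ne h2a.ne'
        hEd (by exact_mod_cast hEr) (le_trans (le_add_of_nonneg_right hA) hle)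
  · obtain ⟨D, hD, hDG, hle⟩ := hpts v₁ v₂
    exact ⟨D, hDG, D, ⟨hD, linEquiv_of_invariants rfl rfl fun i => rfl⟩, hle⟩
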